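/- Theorem 3.1. Let $0\le p\le n$ and let $\langle X,Y\rangle=\sum_{i=1}^{n-p+1}x_iy_i-\sum_{i=n-p+2}^{n+2}x_iy_i$ on $\mathbb R^{n+2}$. Let $C^{n+1}=\{X\neq 0:\langle X,X\rangle=0\}$, let $\mathbb Q_p^n=\{[X]\in\mathbb RP^{n+1}:\langle X,X\rangle=0\}\cong(\mathbb S^{n-p}\times\mathbb S^p)/\{\pm1\}$, and let $h$ be the metric on $\mathbb Q_p^n$ induced by $g_{\mathbb S^{n-p}}\oplus(-g_{\mathbb S^p})$. The group $O(n-p+1,p+1)$ of the matrices preserving $\langle\cdot,\cdot\rangle$ acts on $\mathbb Q_p^n$ by $\Phi_T([X])=[XT]$. Let $M$ be a smooth manifold of dimension $m\ge 2$ and let $x:M\to\mathbb Q_p^n$ be a pseudo-Riemannian submanifold, that is, a smooth map such that $x^*h$ is nondegenerate at every point. A local lift of $x$ is a smooth map $y:U\to C^{n+1}$ on an open set $U\subset M$ with $[y]=x|_U$. Fix a sign $\varepsilon\in\{1,-1\}$. 1. For every local lift $y$, the symmetric form $\langle dy,dy\rangle$ is a (nondegenerate) pseudo-Riemannian metric on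 $U$. Let $\Delta$ be its Laplacian and $\kappa$ its normalized scalar curvature (the scalar curvature divided by $m(m-1)$), and put $$g_y=\varepsilon\,\bigl(\langle\Delta y,\Delta y\rangle-m^2\kappa\bigr)\,\langle dy,dy\rangle .$$ 2. The form $g_y$ does not depend on the lift: if $y:U\to C^{n+1}$ and $\tilde y:\tilde U\to C^{n+1}$ are local lifts of $x$, then $g_y=g_{\tilde y}$ on $U\cap\tilde U$. 3. Consequently there is exactly one globally defined field $g$ of bilinear forms on the tangent spaces of $M$ with $g|_U=g_y$ for every local lift $y:U\to C^{n+1}$ of $x$, and this $g$ is smooth. 4. The form $g$ is invariant under the Lorentzian group: for every $T\in O(n-p+1,p+1)$ the map $\Phi_T\circ x$ is again a pseudo-Riemannian submanifold, and its form (for the same $\varepsilon$) is $g$. -/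

import Mathlib

open scoped Manifold ContDiff Matrix LinearAlgebra.Projectivization

noncomputable section

namespace ConformalGeometry

/-! ### The pseudo-Euclidean space of dimension `n + 2` and index `p + 1`, its cone and the
conformal space -/

/-- The underlying vector space `ℝ^(n+2)`. -/
abbrev Amb (n : ℕ) : Type := Fin (n + 2) → ℝ

/-- The sign of the `i`-th coordinate (counted from `0`) in the inner product of index `p + 1`:
the first `n - p + 1` coordinates are positive, the last `p + 1` are negative. -/
def sgn (n p : ℕ) (i : Fin (n + 2)) : ℝ := if (i : ℕ) + p < n + 1 then 1 else -1

/-- The Lorentzian inner product `⟨X, Y⟩ = ∑_{i ≤ n-p+1} x_i y_i - ∑_{i > n-p+1} x_i y_i`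
on `ℝ^(n+2)`, as a continuous bilinear form. -/
def lor (n p : ℕ) : Amb n →L[ℝ] Amb n →L[ℝ] ℝ :=
  ∑ i : Fin (n + 2),
    (ContinuousLinearMap.proj (R := ℝ) (φ := fun _ : Fin (n + 2) => ℝ) i).smulRight
      (sgn n p i • ContinuousLinearMap.proj (R := ℝ) (φ := fun _ : Fin (n + 2) => ℝ) i)

theorem lor_apply (n p : ℕ) (X Y : Amb n) : lor n p X Y = ∑ i, sgn n p i * (X i * Y i) := by
  simp only [lor, sum_apply, ContinuousLinearMap.smulRight_apply,
    smul_apply, ContinuousLinearMap.proj_apply, smul_eq_mul]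
  exact Finset.sum_congr rfl fun i _ => by ring

/-- The cone of nonzero null vectors. -/
def nullCone (n p : ℕ) : Set (Amb n) := {X | lor n p X X = 0 ∧ X ≠ 0}

/-- The conformal space: the set of the points `[X]` of projective space with `⟨X, X⟩ = 0`. -/
def ConformalSpace (n p : ℕ) : Type :=
  {P : ℙ ℝ (Amb n) // ∃ X : Amb n, ∃ hX : X ∈ nullCone n p, Projectivization.mk ℝ X hX.2 = P}

/-- The point `[X]` of the conformal space given by a vector `X` of the cone. -/
def ConformalSpace.mk {n p : ℕ} (X : Amb n) (hX : X ∈ nullCone n p) : ConformalSpace n p :=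
  ⟨Projectivization.mk ℝ X hX.2, X, hX, rfl⟩

/-- The set `S^(n-p) × S^p` of the `X` with `∑_{i ≤ n-p+1} x_i² = 1 = ∑_{i > n-p+1} x_i²`. The map
`X ↦ [X]` from it to the conformal space is the quotient by `X ↦ -X`. -/
def sphereProduct (n p : ℕ) : Set (Amb n) :=
  {X | (∑ i ∈ Finset.univ.filter (fun i : Fin (n + 2) => (i : ℕ) + p < n + 1), X i ^ 2) = 1 ∧
    (∑ i ∈ Finset.univ.filter (fun i : Fin (n + 2) => ¬ (i : ℕ) + p < n + 1), X i ^ 2) = 1}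

/-! ### The Lorentzian group and its action on the conformal space -/

/-- The group `O(n-p+1, p+1)` of the matrices `T` with `⟨X T, Y T⟩ = ⟨X, Y⟩`
for all row vectors `X`, `Y`. -/
def lorentzGroup (n p : ℕ) : Subgroup (GL (Fin (n + 2)) ℝ) where
  carrier := {T | ∀ X Y : Amb n,
    lor n p (X ᵥ* (T : Matrix (Fin (n + 2)) (Fin (n + 2)) ℝ))
      (Y ᵥ* (T : Matrix (Fin (n + 2)) (Fin (n + 2)) ℝ)) = lor n p X Y}
  one_mem' := by intro X Y; simp
  mul_mem' := by
    intro S T hS hT X Y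
    simp only [Units.val_mul, ← Matrix.vecMul_vecMul]
    rw [hT, hS]
  inv_mem' := by
    intro T hT X Y
    rw [← hT]
    simp only [Matrix.vecMul_vecMul, ← Units.val_mul, inv_mul_cancel, Units.val_one,
      Matrix.vecMul_one]

theorem vecMul_ne_zero {n : ℕ} (T : GL (Fin (n + 2)) ℝ) {X : Amb n} (hX : X ≠ 0) :
    X ᵥ* (T : Matrix (Fin (n + 2)) (Fin (n + 2)) ℝ) ≠ 0 := by
  intro h
  apply hX
  have h2 := congrArg (fun Z => Z ᵥ* ((T⁻¹ : GL (Fin (n + 2)) ℝ) :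
    Matrix (Fin (n + 2)) (Fin (n + 2)) ℝ)) h
  simpa only [Matrix.vecMul_vecMul, ← Units.val_mul, mul_inv_cancel, Units.val_one,
    Matrix.vecMul_one, Matrix.zero_vecMul] using h2

/-- The transformation `[X] ↦ [X T]` of the conformal space given by `T` in `O(n-p+1, p+1)`. -/
def lorentzMap {n p : ℕ} (T : lorentzGroup n p) (P : ConformalSpace n p) : ConformalSpace n p :=
  ⟨Projectivization.map
      (Matrix.vecMulLinear ((T : GL (Fin (n + 2)) ℝ) : Matrix (Fin (n + 2)) (Fin (n + 2)) ℝ))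
      ((injective_iff_map_eq_zero _).2 fun _ h => by_contra fun hX =>
        vecMul_ne_zero (T : GL (Fin (n + 2)) ℝ) hX h) P.1, by
    obtain ⟨X, hX, hP⟩ := P.2
    refine ⟨X ᵥ* _, ⟨?_, vecMul_ne_zero (T : GL (Fin (n + 2)) ℝ) hX.2⟩, ?_⟩
    · exact (T.2 X X).trans hX.1
    · rw [← hP]; rfl⟩

theorem lorentzMap_mk {n p : ℕ} (T : lorentzGroup n p) (X : Amb n) (hX : X ∈ nullCone n p) :
    lorentzMap T (.mk X hX) =
      .mk (X ᵥ* ((T : GL (Fin (n + 2)) ℝ) : Matrix (Fin (n + 2)) (Fin (n + 2)) ℝ))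
        ⟨(T.2 X X).trans hX.1, vecMul_ne_zero (T : GL (Fin (n + 2)) ℝ) hX.2⟩ := rfl

/-! ### Laplacian and curvature of a pseudo-Riemannian metric in local coordinates -/

section Coordinates

variable {m : ℕ} {W : Type*} [NormedAddCommGroup W] [NormedSpace ℝ W]

/-- The partial derivative `∂f/∂u^i`. -/
def pd (i : Fin m) (f : EuclideanSpace ℝ (Fin m) → W) (u : EuclideanSpace ℝ (Fin m)) : W :=
  fderiv ℝ f u (EuclideanSpace.single i 1)

variable (G : EuclideanSpace ℝ (Fin m) → Matrix (Fin m) (Fin m) ℝ)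

/-- Christoffel symbols
`Γ^k_{ij} = 1/2 ∑_l g^{kl} (∂_i g_{jl} + ∂_j g_{il} - ∂_l g_{ij})` of the metric `(g_{ij}) = G`. -/
def christoffel (k i j : Fin m) (u : EuclideanSpace ℝ (Fin m)) : ℝ :=
  (1 / 2 : ℝ) * ∑ l, (G u)⁻¹ k l *
    (pd i (fun v => G v j l) u + pd j (fun v => G v i l) u - pd l (fun v => G v i j) u)

/-- The Laplacian `Δf = ∑_{ij} g^{ij} (∂_i ∂_j f - ∑_k Γ^k_{ij} ∂_k f)` of a function with values
in a vector space. -/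
def laplacian (f : EuclideanSpace ℝ (Fin m) → W) (u : EuclideanSpace ℝ (Fin m)) : W :=
  ∑ i, ∑ j, (G u)⁻¹ i j • (pd i (pd j f) u - ∑ k, christoffel G k i j u • pd k f u)

/-- The curvature tensor `R^l_{kij}`, the `∂_l` component of
`∇_{∂_i} ∇_{∂_j} ∂_k - ∇_{∂_j} ∇_{∂_i} ∂_k`. -/
def riemann (l k i j : Fin m) (u : EuclideanSpace ℝ (Fin m)) : ℝ :=
  pd i (christoffel G l j k) u - pd j (christoffel G l i k) u +
    ∑ a, (christoffel G l i a u * christoffel G a j k u -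
      christoffel G l j a u * christoffel G a i k u)

/-- The Ricci tensor `R_{kj} = ∑_i R^i_{kij}`. -/
def ricci (k j : Fin m) (u : EuclideanSpace ℝ (Fin m)) : ℝ := ∑ i, riemann G i k i j u

/-- The normalized scalar curvature `κ = (m (m - 1))⁻¹ ∑_{kj} g^{kj} R_{kj}`. -/
def normScalarCurvature (u : EuclideanSpace ℝ (Fin m)) : ℝ :=
  (∑ k, ∑ j, (G u)⁻¹ k j * ricci G k j u) / ((m : ℝ) * ((m : ℝ) - 1))

/-- The matrix `⟨∂_i F, ∂_j F⟩` of the metric `⟨dF, dF⟩`. -/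
def inducedMatrix (n p : ℕ) (F : EuclideanSpace ℝ (Fin m) → Amb n)
    (u : EuclideanSpace ℝ (Fin m)) : Matrix (Fin m) (Fin m) ℝ :=
  Matrix.of fun i j => lor n p (pd i F u) (pd j F u)

end Coordinates

/-! ### Submanifolds of the conformal space, local lifts and the conformal 2-form -/

section Submanifold

variable (m : ℕ) {n p : ℕ} {M : Type*} [TopologicalSpace M] [ChartedSpace (EuclideanSpace ℝ (Fin m)) M]

/-- `y` is, on the open set `U`, a smooth map into the cone with `[y] = x`. The values of `y`
outside `U` play no role. -/
def IsLocalLift (x : M → ConformalSpace n p) (U : Set M) (y : M → Amb n) : Prop :=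
  IsOpen U ∧ ContMDiffOn (𝓡 m) 𝓘(ℝ, Amb n) ∞ y U ∧
    ∀ q ∈ U, ∃ hq : y q ∈ nullCone n p, ConformalSpace.mk (y q) hq = x q

/-- The symmetric bilinear form `⟨dy, dy⟩` on the tangent space at `q`. -/
def inducedForm (p : ℕ) (y : M → Amb n) (q : M) :
    TangentSpace (𝓡 m) q →L[ℝ] TangentSpace (𝓡 m) q →L[ℝ] ℝ :=
  let dy : EuclideanSpace ℝ (Fin m) →L[ℝ] Amb n := mfderiv (𝓡 m) 𝓘(ℝ, Amb n) y q
  (lor n p).bilinearComp dy dy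

/-- Nondegeneracy of a symmetric bilinear form on a tangent space. -/
def NondegenerateAt {q : M}
    (B : TangentSpace (𝓡 m) q →L[ℝ] TangentSpace (𝓡 m) q →L[ℝ] ℝ) : Prop :=
  ∀ v, (∀ w, B v w = 0) → v = 0

/-- `x` is an `m`-dimensional pseudo-Riemannian submanifold: a smooth map into the conformal space
`(S^(n-p) × S^p) / ±1`, such that the pull-back of the metric `h = g_{S^(n-p)} ⊕ (-g_{S^p})` is
nondegenerate (equivalently, `x` is an immersion and the image of its differential is a
nondegenerate subbundle).
Since `S^(n-p) × S^p` is a double covering of the conformal space, and `h` is the metric whose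
pull-back to `S^(n-p) × S^p` is the restriction of the Lorentzian inner product,
smoothness of `x` means that `x` has, near each point, a smooth lift `y` into `S^(n-p) × S^p`, and
the pull-back of `h` by `x` is `⟨dy, dy⟩` there. -/
def IsPseudoRiemannianSubmanifold (x : M → ConformalSpace n p) : Prop :=
  ∀ q : M, ∃ (U : Set M) (y : M → Amb n), q ∈ U ∧ IsLocalLift m x U y ∧
    (∀ r ∈ U, y r ∈ sphereProduct n p) ∧ NondegenerateAt m (inducedForm m p y q)

/-- The function `⟨Δy, Δy⟩ - m² κ` at `q`, where `Δ` and `κ` are the Laplacian and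
the normalized scalar curvature of the metric `⟨dy, dy⟩`, computed in the coordinates `φ`. -/
def conformalFactor (p : ℕ) (φ : OpenPartialHomeomorph M (EuclideanSpace ℝ (Fin m)))
    (y : M → Amb n) (q : M) : ℝ :=
  let F : EuclideanSpace ℝ (Fin m) → Amb n := y ∘ φ.symm
  let G := inducedMatrix n p F
  lor n p (laplacian G F (φ q)) (laplacian G F (φ q)) -
    (m : ℝ) ^ 2 * normScalarCurvature G (φ q)

/-- The form `ε (⟨Δy, Δy⟩ - m² κ) ⟨dy, dy⟩` on the tangent space at `q` (with `ε = ±1`). -/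
def conformalForm (p : ℕ) (ε : ℝ) (φ : OpenPartialHomeomorph M (EuclideanSpace ℝ (Fin m)))
    (y : M → Amb n) (q : M) : TangentSpace (𝓡 m) q →L[ℝ] TangentSpace (𝓡 m) q →L[ℝ] ℝ :=
  (ε * conformalFactor m p φ y q) • inducedForm m p y q

variable [IsManifold (𝓡 m) ∞ M]

/-- `g` is a smooth field of bilinear forms on all of `M` which is given by
`ε (⟨Δy, Δy⟩ - m² κ) ⟨dy, dy⟩` for every local lift `y` of `x`, in all coordinates of the smooth
structure of `M`. -/
def IsConformalTwoForm (x : M → ConformalSpace n p) (ε : ℝ)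
    (g : ∀ q : M, TangentSpace (𝓡 m) q →L[ℝ] TangentSpace (𝓡 m) q →L[ℝ] ℝ) : Prop :=
  ContMDiff (𝓡 m)
      ((𝓡 m).prod 𝓘(ℝ, EuclideanSpace ℝ (Fin m) →L[ℝ] EuclideanSpace ℝ (Fin m) →L[ℝ] ℝ)) ∞
      (fun q => Bundle.TotalSpace.mk'
        (EuclideanSpace ℝ (Fin m) →L[ℝ] EuclideanSpace ℝ (Fin m) →L[ℝ] ℝ) q (g q)) ∧
    ∀ (U : Set M) (y : M → Amb n), IsLocalLift m x U y →
      ∀ φ ∈ IsManifold.maximalAtlas (𝓡 m) ∞ M, ∀ q ∈ U ∩ φ.source, g q = conformalForm m p ε φ y q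

end Submanifold

end ConformalGeometry

end

/-!
# The conformal 2-form of a submanifold of the conformal space

Write a local lift in coordinates as a map `F` into the null cone, with `g = ⟨dF, dF⟩`. The forms
attached to two lifts agree because `⟨ΔF, ΔF⟩ - m² κ` is, up to a constant, the squared length of a
tensor with an obvious transformation law, so that the conformal change of the scalar curvature and
the coordinate invariance of the curvature tensor never have to be computed.

Indeed the ambient space is flat, so the Gauss equation (`sum_inducedMatrix_mul_riemann`) expresses
the curvature of `g` by the normal Hessian `H_{ij} = ∂_i ∂_j F - ∑_k Γ^k_{ij} ∂_k F`. Since `ΔF` is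
the `g`-trace of `H`, taking traces gives `m (m - 1) κ = ⟨ΔF, ΔF⟩ - |H|²`, that is
(`coordFactor_eq`)
`⟨ΔF, ΔF⟩ - m² κ = m / (m - 1) * |K|²` with `K_{ij} = H_{ij} - g_{ij} ΔF / m`.

Let `F' = τ • (F ∘ ψ)` be another lift in other coordinates, with Jacobian matrix `J` of `ψ`, and
let `W` be the span of `F` and the `∂_i F`. It contains the `∂_a F'`, and `∂_a ∂_b F'` agrees with
`τ ∑_{ij} J_{ia} J_{jb} ∂_i ∂_j F` modulo `W`. As `F` is null, `⟨∂_i ∂_j F, F⟩ = -g_{ij}`, so the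
trace-free tensor `K` is orthogonal to `F` and hence to all of `W`. The difference of `K'` and
`τ Jᵀ K J` is therefore orthogonal to `W`, and it lies in `W` because both tensors are trace-free
and `g'` is conformal to the pull-back of `g`. The intersection of `W` with its orthogonal
complement is the null line through `F`; so the difference does not contribute to inner products
(`exists_traceFreePart_eq`), and `|K'|² = τ⁻² |K|²` (`contraction_traceFreePart_pullback`). This
cancels the factor `τ²` in `⟨dF', dF'⟩ = τ² ⟨dF, dF⟩` (`conformalForm_eq`).

Smoothness holds because in a chart everything is a rational expression in derivatives of the lift
(`contMDiffAt_conformalForm`). For the invariance under `T`, lifts of `x` correspond to lifts of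
its image by `y ↦ y T`, and all ingredients are defined by `⟨·, ·⟩`; a lift `y T` has to be
rescaled to return to the product of the spheres (`IsLocalLift.normalize`).
-/

noncomputable section

namespace ConformalGeometry

/-! ### Linear algebra of the second fundamental form -/

section Algebra

variable {ι V : Type*} [NormedAddCommGroup V] [NormedSpace ℝ V]

/-- The Gram matrix `⟨e_i, e_j⟩` of a family of vectors. -/
def gram (B : V →L[ℝ] V →L[ℝ] ℝ) (e : ι → V) : Matrix ι ι ℝ := Matrix.of fun i j => B (e i) (e j)

variable {B : V →L[ℝ] V →L[ℝ] ℝ}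

theorem gram_apply (e : ι → V) (i j : ι) : gram B e i j = B (e i) (e j) := rfl

theorem gram_transpose (hB : ∀ v w, B v w = B w v) (e : ι → V) :
    (gram B e)ᵀ = gram B e := by
  ext i j
  exact hB _ _

variable [Fintype ι] [DecidableEq ι] (B)

/-- The component of `v` orthogonal to the `e_k`, meaningful when their Gram matrix is
invertible. -/
def normalPart (e : ι → V) (v : V) : V :=
  v - ∑ k, (∑ l, (gram B e)⁻¹ k l * B v (e l)) • e k

/-- The trace, with respect to the metric `⟨e_i, e_j⟩`, of the normal part of a family `A_{ij}`. For
the second derivatives of an immersion it is the Laplacian, `m` times the mean curvature vector. -/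
def normalTrace (e : ι → V) (A : ι → ι → V) : V :=
  ∑ i, ∑ j, (gram B e)⁻¹ i j • normalPart B e (A i j)

/-- The trace-free part, with respect to the metric `⟨e_i, e_j⟩`, of the normal part of a family
`A_{ij}`. -/
def traceFreePart (e : ι → V) (A : ι → ι → V) (i j : ι) : V :=
  normalPart B e (A i j) - (gram B e i j / Fintype.card ι) • normalTrace B e A

/-- The full contraction `∑ P^{kj} P^{il} ⟨f_{jl}, h_{ik}⟩`. -/
def contraction (P : Matrix ι ι ℝ) (f h : ι → ι → V) : ℝ :=
  ∑ k, ∑ j, P k j * ∑ i, ∑ l, P i l * B (f j l) (h i k)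

variable {B}

theorem apply_normalPart (hB : ∀ v w, B v w = B w v) {e : ι → V}
    (he : IsUnit (gram B e).det) (v : V) (i : ι) : B (normalPart B e v) (e i) = 0 := by
  have h1 : ∑ k, (∑ l, (gram B e)⁻¹ k l * B v (e l)) * B (e k) (e i) = B v (e i) := by
    have h := congrFun (congrArg (fun N => N *ᵥ (fun l => B v (e l)))
      (Matrix.mul_nonsing_inv _ he)) i
    simp only [← Matrix.mulVec_mulVec, Matrix.one_mulVec] at h
    rw [← h]
    simp only [Matrix.mulVec, dotProduct]
    refine Finset.sum_congr rfl fun k _ => ?_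
    rw [mul_comm, hB, gram_apply]
  simp [normalPart, h1]

/-- Contraction of `g_{jl} f_{ik}` with `P ⊗ P`, where `P` is the inverse of `g`. -/
theorem sum_inv_mul_inv_mul {P g : Matrix ι ι ℝ} (hPg : P * g = 1) (f : ι → ι → ℝ) :
    ∑ k, ∑ j, P k j * ∑ i, ∑ l, P i l * (g j l * f i k) = ∑ i, ∑ k, P i k * f i k := by
  have h : ∀ k l, ∑ j, P k j * g j l = if k = l then 1 else 0 := fun k l => by
    rw [← Matrix.mul_apply, hPg, Matrix.one_apply]
  calc ∑ k, ∑ j, P k j * ∑ i, ∑ l, P i l * (g j l * f i k)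
      = ∑ k, ∑ i, ∑ l, (∑ j, P k j * g j l) * (P i l * f i k) := by
        refine Finset.sum_congr rfl fun k _ => ?_
        simp only [Finset.mul_sum, Finset.sum_mul]
        rw [Finset.sum_comm]
        refine Finset.sum_congr rfl fun i _ => ?_
        rw [Finset.sum_comm]
        refine Finset.sum_congr rfl fun l _ => Finset.sum_congr rfl fun j _ => by ring
    _ = ∑ i, ∑ k, P i k * f i k := by
        simp only [h, ite_mul, one_mul, zero_mul, Finset.sum_ite_eq, Finset.mem_univ, if_true]
        exact Finset.sum_comm

theorem sum_inv_mul_inv_mul' {P g : Matrix ι ι ℝ} (hP : Pᵀ = P) (hg : gᵀ = g) (hPg : P * g = 1)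
    (f : ι → ι → ℝ) :
    ∑ k, ∑ j, P k j * ∑ i, ∑ l, P i l * (g i k * f j l) = ∑ i, ∑ k, P i k * f i k := by
  have hP' : ∀ i j, P i j = P j i := fun i j => congrFun (congrFun hP.symm i) j
  have hg' : ∀ i j, g i j = g j i := fun i j => congrFun (congrFun hg.symm i) j
  rw [← sum_inv_mul_inv_mul hPg f]
  simp only [Finset.mul_sum]
  calc ∑ k, ∑ j, ∑ i, ∑ l, P k j * (P i l * (g i k * f j l))
      = ∑ j, ∑ k, ∑ l, ∑ i, P k j * (P i l * (g i k * f j l)) := by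
        rw [Finset.sum_comm]
        exact Finset.sum_congr rfl fun _ _ => Finset.sum_congr rfl fun _ _ => Finset.sum_comm
    _ = ∑ l, ∑ k, ∑ j, ∑ i, P k j * (P i l * (g i k * f j l)) := by
        rw [Finset.sum_comm]
        rw [Finset.sum_congr rfl fun k _ => Finset.sum_comm, Finset.sum_comm]
    _ = ∑ l, ∑ i, ∑ j, ∑ k, P k j * (P i l * (g i k * f j l)) := by
        refine Finset.sum_congr rfl fun l _ => ?_
        rw [Finset.sum_congr rfl fun k _ => Finset.sum_comm, Finset.sum_comm]
        exact Finset.sum_congr rfl fun i _ => Finset.sum_comm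
    _ = _ := by
        refine Finset.sum_congr rfl fun l _ => Finset.sum_congr rfl fun i _ =>
          Finset.sum_congr rfl fun j _ => Finset.sum_congr rfl fun k _ => ?_
        rw [hP' k j, hP' i l, hg' i k]; ring

theorem sum_inv_mul_self {P g : Matrix ι ι ℝ} (hg : gᵀ = g) (hPg : P * g = 1) :
    ∑ i, ∑ k, P i k * g i k = Fintype.card ι := by
  have h : ∀ i, ∑ k, P i k * g i k = 1 := fun i => by
    have := congrFun (congrFun hPg i) i
    rw [Matrix.mul_apply, Matrix.one_apply_eq] at this
    rw [← this]
    exact Finset.sum_congr rfl fun k _ => by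
      rw [show g i k = g k i from congrFun (congrFun hg.symm i) k]
  simp [h]

/-- Pythagoras: `|H|² = |K|² + |L|² / m` for the trace-free part `K` and the trace `L` of `H`. -/
theorem contraction_traceFreePart [Nonempty ι] (hB : ∀ v w, B v w = B w v) {e : ι → V}
    (he : IsUnit (gram B e).det) (A : ι → ι → V) :
    contraction B (gram B e)⁻¹ (traceFreePart B e A) (traceFreePart B e A) =
      contraction B (gram B e)⁻¹ (fun i j => normalPart B e (A i j))
        (fun i j => normalPart B e (A i j)) -
        B (normalTrace B e A) (normalTrace B e A) / Fintype.card ι := by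
  set g := gram B e with hgdef
  set L := normalTrace B e A with hL
  set H := fun i j => normalPart B e (A i j) with hH
  have hPg : g⁻¹ * g = 1 := Matrix.nonsing_inv_mul _ he
  have hgt : gᵀ = g := gram_transpose hB e
  have hPt : (g⁻¹)ᵀ = g⁻¹ := by rw [Matrix.transpose_nonsing_inv, hgt]
  have hm : (Fintype.card ι : ℝ) ≠ 0 := by
    exact_mod_cast Fintype.card_ne_zero
  set c : ℝ := 1 / Fintype.card ι with hc
  have hLL : ∑ i, ∑ k, g⁻¹ i k * B (H i k) L = B L L := by
    have h : B L = B (∑ i, ∑ j, g⁻¹ i j • H i j) := rfl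
    rw [h]
    generalize L = L'
    simp only [map_sum, map_smul, sum_apply, smul_apply, smul_eq_mul]
  have hK : ∀ i j k l, B (traceFreePart B e A j l) (traceFreePart B e A i k) =
      B (H j l) (H i k) - c * (g j l * B (H i k) L) - c * (g i k * B (H j l) L)
        + c ^ 2 * (g j l * (g i k * B L L)) := by
    intro i j k l
    simp only [traceFreePart, ← hgdef, ← hL, hH, map_sub, map_smul, sub_apply, smul_apply,
      smul_eq_mul, hc]
    rw [hB L]
    ring
  simp only [contraction, hK, mul_add, mul_sub, Finset.sum_add_distrib, Finset.sum_sub_distrib]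
  have e1 : ∀ f : ι → ι → ι → ι → ℝ, ∀ a : ℝ,
      ∑ k, ∑ j, g⁻¹ k j * ∑ i, ∑ l, g⁻¹ i l * (a * f i j k l) =
        a * ∑ k, ∑ j, g⁻¹ k j * ∑ i, ∑ l, g⁻¹ i l * f i j k l := by
    intro f a
    simp only [Finset.mul_sum]
    refine Finset.sum_congr rfl fun _ _ => Finset.sum_congr rfl fun _ _ =>
      Finset.sum_congr rfl fun _ _ => Finset.sum_congr rfl fun _ _ => by ring
  rw [e1 (fun i j k l => g j l * B (H i k) L), e1 (fun i j k l => g i k * B (H j l) L),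
    e1 (fun i j k l => g j l * (g i k * B L L)),
    sum_inv_mul_inv_mul hPg (fun i k => B (H i k) L), sum_inv_mul_inv_mul' hPt hgt hPg,
    sum_inv_mul_inv_mul hPg (fun i k => g i k * B L L), hLL]
  simp only [← mul_assoc, ← Finset.sum_mul]
  rw [sum_inv_mul_self hgt hPg, hc]
  field_simp
  ring

end Algebra

/-! ### The trace-free part under a change of frame -/

section ChangeOfFrame

variable {ι V : Type*} [NormedAddCommGroup V] [NormedSpace ℝ V] {B : V →L[ℝ] V →L[ℝ] ℝ}
  [Fintype ι]

/-- Contraction of a pulled back family with the inverse of the pulled back metric. -/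
theorem sum_inv_smul_pullback {W : Type*} [AddCommGroup W] [Module ℝ W]
    {P Q J : Matrix ι ι ℝ} (h : J * P * Jᵀ = Q) (f : ι → ι → W) :
    ∑ a, ∑ b, P a b • ∑ i, ∑ j, (J i a * J j b) • f i j = ∑ i, ∑ j, Q i j • f i j := by
  have hQ : ∀ i j, Q i j = ∑ a, ∑ b, P a b * (J i a * J j b) := fun i j => by
    rw [← h, Matrix.mul_apply, Finset.sum_comm]
    refine Finset.sum_congr rfl fun b _ => ?_
    rw [Matrix.mul_apply, Finset.sum_mul]
    exact Finset.sum_congr rfl fun a _ => by rw [Matrix.transpose_apply]; ring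
  simp only [hQ, Finset.sum_smul, Finset.smul_sum, smul_smul]
  calc _ = ∑ a, ∑ i, ∑ j, ∑ b, (P a b * (J i a * J j b)) • f i j := by
        refine Finset.sum_congr rfl fun a _ => ?_
        rw [Finset.sum_comm]
        exact Finset.sum_congr rfl fun i _ => Finset.sum_comm
    _ = _ := by
        rw [Finset.sum_comm]
        exact Finset.sum_congr rfl fun i _ => Finset.sum_comm

theorem contraction_pullback {P Q J : Matrix ι ι ℝ} (h : J * P * Jᵀ = Q) (f k : ι → ι → V) :
    contraction B P (fun a b => ∑ i, ∑ j, (J i a * J j b) • f i j)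
      (fun a b => ∑ i, ∑ j, (J i a * J j b) • k i j) = contraction B Q f k := by
  have h1 : ∀ a b c d : ι, B (∑ i, ∑ j, (J i a * J j b) • f i j)
      (∑ i, ∑ j, (J i c * J j d) • k i j) = ∑ i, ∑ j, (J i c * J j b) •
        B (∑ r, J r a • f r j) (∑ r, J r d • k i r) := by
    intro a b c d
    have e1 : (∑ i, ∑ j, (J i a * J j b) • f i j) = ∑ j, J j b • ∑ r, J r a • f r j := by
      rw [Finset.sum_comm]
      refine Finset.sum_congr rfl fun j _ => ?_
      rw [Finset.smul_sum]
      exact Finset.sum_congr rfl fun r _ => by rw [smul_smul, mul_comm]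
    have e2 : (∑ i, ∑ j, (J i c * J j d) • k i j) = ∑ i, J i c • ∑ r, J r d • k i r := by
      simp only [Finset.smul_sum, smul_smul]
    rw [e1, e2]
    generalize (fun j => ∑ r, J r a • f r j) = F
    simp only [map_sum, map_smul, sum_apply, smul_apply, smul_eq_mul, Finset.mul_sum]
    refine Finset.sum_congr rfl fun i _ => ?_
    rw [Finset.sum_comm]
    refine Finset.sum_congr rfl fun j _ => Finset.sum_congr rfl fun r _ =>
      Finset.sum_congr rfl fun s _ => by ring
  have h2 : ∀ (c : ι → ι → ℝ) (a d : ι),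
      ∑ i, ∑ j, c i j • B (∑ r, J r a • f r j) (∑ r, J r d • k i r) =
      ∑ r, ∑ s, (J r d * J s a) • ∑ i, ∑ j, c i j * B (f s j) (k i r) := by
    intro c a d
    simp only [map_sum, map_smul, sum_apply, smul_apply, smul_eq_mul, Finset.mul_sum]
    calc _ = ∑ i, ∑ r, ∑ j, ∑ s, c i j * (J r d * (J s a * B (f s j) (k i r))) := by
          exact Finset.sum_congr rfl fun i _ => Finset.sum_comm
      _ = ∑ r, ∑ i, ∑ s, ∑ j, c i j * (J r d * (J s a * B (f s j) (k i r))) := by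
          rw [Finset.sum_comm]
          exact Finset.sum_congr rfl fun i _ => Finset.sum_congr rfl fun r _ => Finset.sum_comm
      _ = _ := by
          refine Finset.sum_congr rfl fun r _ => ?_
          rw [Finset.sum_comm]
          refine Finset.sum_congr rfl fun s _ => Finset.sum_congr rfl fun i _ =>
            Finset.sum_congr rfl fun j _ => by ring
  have h3 := sum_inv_smul_pullback (W := ℝ) h
  simp only [smul_eq_mul] at h1 h2 h3
  simp only [contraction, h1, h3]
  simp only [fun a d => h2 (fun i j => Q i j) a d, h3]

theorem gram_pullback (hB : ∀ v w, B v w = B w v) {X : V} (hX : B X X = 0)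
    {e e' : ι → V} {τ : ℝ} {J : Matrix ι ι ℝ} {c : ι → ℝ} (heX : ∀ i, B (e i) X = 0)
    (hee : ∀ a, e' a = τ • ∑ i, J i a • e i + c a • X) (a b : ι) :
    gram B e' a b = τ ^ 2 * ∑ i, ∑ j, (J i a * J j b) * gram B e i j := by
  have hXe : ∀ i, B X (e i) = 0 := fun i => by rw [hB, heX]
  simp only [gram_apply, hee, map_add, map_sum, map_smul, add_apply, sum_apply, smul_apply,
    smul_eq_mul, heX, hXe, hX, mul_zero, Finset.sum_const_zero, add_zero, Finset.mul_sum]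
  rw [Finset.sum_comm]
  refine Finset.sum_congr rfl fun i _ => Finset.sum_congr rfl fun j _ => by ring

/-- The double trace of the right-hand side of the Gauss equation. -/
theorem sum_mul_sum_mul_sub (hB : ∀ v w, B v w = B w v) (P : Matrix ι ι ℝ) {H : ι → ι → V}
    (hH : ∀ i j, H i j = H j i) :
    ∑ k, ∑ j, P k j * ∑ i, ∑ l, P i l * (B (H i l) (H j k) - B (H j l) (H i k)) =
      B (∑ i, ∑ j, P i j • H i j) (∑ i, ∑ j, P i j • H i j) - contraction B P H H := by
  simp only [contraction, mul_sub, Finset.sum_sub_distrib]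
  congr 1
  generalize hL : ∑ i, ∑ j, P i j • H i j = L
  have h : ∀ v, ∑ i, ∑ l, P i l * B (H i l) v = B L v := by
    intro v
    simp only [← hL, map_sum, map_smul, sum_apply, smul_apply, smul_eq_mul]
  simp only [h, hH _]
  rw [← h L]
  refine Finset.sum_congr rfl fun k _ => Finset.sum_congr rfl fun j _ => ?_
  rw [hB L, hH]

variable [DecidableEq ι]

theorem normalPart_sub_mem_span (e : ι → V) (v : V) :
    normalPart B e v - v ∈ Submodule.span ℝ (Set.range e) := by
  rw [normalPart, sub_sub_cancel_left]
  exact neg_mem (sum_mem fun k _ => Submodule.smul_mem _ _ (Submodule.subset_span ⟨k, rfl⟩))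

theorem apply_normalTrace (hB : ∀ v w, B v w = B w v) {e : ι → V}
    (he : IsUnit (gram B e).det) (A : ι → ι → V) (l : ι) : B (normalTrace B e A) (e l) = 0 := by
  simp [normalTrace, sum_apply, apply_normalPart hB he]

theorem apply_traceFreePart (hB : ∀ v w, B v w = B w v) {e : ι → V}
    (he : IsUnit (gram B e).det) (A : ι → ι → V) (i j l : ι) :
    B (traceFreePart B e A i j) (e l) = 0 := by
  simp [traceFreePart, apply_normalTrace hB he, apply_normalPart hB he]

theorem sum_inv_smul_traceFreePart [Nonempty ι] (hB : ∀ v w, B v w = B w v) {e : ι → V}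
    (he : IsUnit (gram B e).det) (A : ι → ι → V) :
    ∑ i, ∑ j, (gram B e)⁻¹ i j • traceFreePart B e A i j = 0 := by
  have hm : (Fintype.card ι : ℝ) ≠ 0 := by exact_mod_cast Fintype.card_ne_zero
  have h := sum_inv_mul_self (gram_transpose hB e) (Matrix.nonsing_inv_mul _ he)
  simp only [traceFreePart, smul_sub, Finset.sum_sub_distrib, smul_smul, ← Finset.sum_smul]
  rw [← normalTrace]
  simp only [← mul_div_assoc, ← Finset.sum_div, h]
  rw [div_self hm, one_smul, sub_self]

/-- When `⟨A_{ij}, X⟩ = -⟨e_i, e_j⟩`, as for the second derivatives of a map `X` into the null cone,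
the contributions of `A_{ij}` and of the trace to `⟨K_{ij}, X⟩` cancel. -/
theorem apply_traceFreePart_position [Nonempty ι] (hB : ∀ v w, B v w = B w v) {e : ι → V}
    (he : IsUnit (gram B e).det) {A : ι → ι → V} {X : V}
    (heX : ∀ i, B (e i) X = 0) (hAX : ∀ i j, B (A i j) X = - gram B e i j) (i j : ι) :
    B (traceFreePart B e A i j) X = 0 := by
  have hm : (Fintype.card ι : ℝ) ≠ 0 := by exact_mod_cast Fintype.card_ne_zero
  have h1 : ∀ i j, B (normalPart B e (A i j)) X = - gram B e i j := by
    simp [normalPart, heX, hAX, sum_apply]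
  have h2 : B (normalTrace B e A) X = - Fintype.card ι := by
    rw [← sum_inv_mul_self (gram_transpose hB e) (Matrix.nonsing_inv_mul _ he)]
    simp [normalTrace, sum_apply, h1]
  simp only [traceFreePart, map_sub, map_smul, sub_apply, smul_apply, h1, h2, smul_eq_mul]
  field_simp
  ring

/-- In the span of `X` and a nondegenerate family `e` orthogonal to `X`, only the multiples of `X`
are orthogonal to `e`. -/
theorem mem_span_singleton_of_orthogonal (hB : ∀ v w, B v w = B w v) {e : ι → V}
    (he : IsUnit (gram B e).det) {X : V} (heX : ∀ i, B (e i) X = 0) {w : V}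
    (hw : w ∈ Submodule.span ℝ (insert X (Set.range e))) (hwe : ∀ i, B w (e i) = 0) :
    ∃ s : ℝ, w = s • X := by
  obtain ⟨s, z, hz, rfl⟩ := Submodule.mem_span_insert.1 hw
  obtain ⟨t, rfl⟩ := (Submodule.mem_span_range_iff_exists_fun ℝ).1 hz
  have h0 : t ᵥ* gram B e = 0 := by
    ext i
    have := hwe i
    rw [map_add, map_smul, add_apply, smul_apply, hB X, heX, smul_zero, zero_add] at this
    simpa [Matrix.vecMul, dotProduct, gram_apply, sum_apply] using this
  have ht : t = 0 := by
    have h1 := congrArg (fun r => r ᵥ* (gram B e)⁻¹) h0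
    simpa [Matrix.vecMul_vecMul, Matrix.mul_nonsing_inv _ he] using h1
  exact ⟨s, by simp [ht]⟩

/-- Transformation of the trace-free part. The hypotheses are those satisfied by the first and
second derivatives `e`, `A` of a map `F` into the null cone and `e'`, `A'` of `τ • (F ∘ ψ)`, at points
where `F` has the value `X` and `ψ` the Jacobian matrix `J`. -/
theorem exists_traceFreePart_eq [Nonempty ι] (hB : ∀ v w, B v w = B w v) {X : V} (hX : B X X = 0)
    {e e' : ι → V} {A A' : ι → ι → V} {τ : ℝ} {J : Matrix ι ι ℝ} {c : ι → ℝ}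
    (he : IsUnit (gram B e).det) (he' : IsUnit (gram B e').det)
    (heX : ∀ i, B (e i) X = 0) (hAX : ∀ i j, B (A i j) X = - gram B e i j)
    (hAX' : ∀ i j, B (A' i j) (τ • X) = - gram B e' i j)
    (hτ : τ ≠ 0) (hee : ∀ a, e' a = τ • ∑ i, J i a • e i + c a • X)
    (hJ : J * (gram B e')⁻¹ * Jᵀ = (τ ^ 2)⁻¹ • (gram B e)⁻¹)
    (hg : ∀ a b, gram B e' a b = τ ^ 2 * ∑ i, ∑ j, (J i a * J j b) * gram B e i j)
    (hAA : ∀ a b, A' a b - τ • ∑ i, ∑ j, (J i a * J j b) • A i j ∈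
      Submodule.span ℝ (insert X (Set.range e))) (a b : ι) :
    ∃ s : ℝ, traceFreePart B e' A' a b =
      τ • ∑ i, ∑ j, (J i a * J j b) • traceFreePart B e A i j + s • X := by
  have hm : (Fintype.card ι : ℝ) ≠ 0 := by exact_mod_cast Fintype.card_ne_zero
  set S := Submodule.span ℝ (insert X (Set.range e)) with hS
  have heS : Submodule.span ℝ (Set.range e) ≤ S := Submodule.span_mono (Set.subset_insert _ _)
  have hXS : X ∈ S := Submodule.subset_span (Set.mem_insert _ _)
  have heS' : Submodule.span ℝ (Set.range e') ≤ S := by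
    rw [Submodule.span_le]
    rintro _ ⟨i, rfl⟩
    rw [hee]
    exact add_mem (Submodule.smul_mem _ _ (sum_mem fun k _ => Submodule.smul_mem _ _
      (heS (Submodule.subset_span ⟨k, rfl⟩)))) (Submodule.smul_mem _ _ hXS)
  -- `D` is orthogonal to `S`, and modulo `S` it is a multiple `-g' Z` of the metric; being
  -- trace-free it forces `Z ∈ S`, hence `D ∈ S`.
  set D : ι → ι → V := fun a b => traceFreePart B e' A' a b -
    τ • ∑ i, ∑ j, (J i a * J j b) • traceFreePart B e A i j with hD
  set Z : V := (Fintype.card ι : ℝ)⁻¹ • normalTrace B e' A' -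
    ((Fintype.card ι : ℝ)⁻¹ * τ⁻¹) • normalTrace B e A with hZ
  have hDX : ∀ a b, B (D a b) X = 0 := by
    intro a b
    have h1 := apply_traceFreePart_position hB he heX hAX
    have h2 := apply_traceFreePart_position hB he' (X := τ • X) (A := A')
      (fun a => by
        rw [hee]
        simp [sum_apply, heX, hX]) hAX' a b
    rw [map_smul, smul_eq_mul] at h2
    have h3 := (mul_eq_zero.1 h2).resolve_left hτ
    simp [hD, h3, sum_apply, h1]
  have hDZ : ∀ a b, D a b + gram B e' a b • Z ∈ S := by
    intro a b
    have h1 := heS' (normalPart_sub_mem_span (B := B) e' (A' a b))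
    have h2 : τ • ∑ i, ∑ j, (J i a * J j b) • (normalPart B e (A i j) - A i j) ∈ S :=
      Submodule.smul_mem _ _ (sum_mem fun i _ => sum_mem fun j _ => Submodule.smul_mem _ _
        (heS (normalPart_sub_mem_span (B := B) e (A i j))))
    have h3 := S.add_mem (S.sub_mem h1 h2) (hAA a b)
    convert h3 using 1
    -- The trace terms combine, since `g'_{ab} = τ² ∑_{ij} J_{ia} J_{jb} g_{ij}`.
    have e1 : τ • ∑ i, ∑ j, (J i a * J j b) • traceFreePart B e A i j =
        τ • ∑ i, ∑ j, (J i a * J j b) • normalPart B e (A i j) -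
          (τ⁻¹ * (gram B e' a b / Fintype.card ι)) • normalTrace B e A := by
      simp only [traceFreePart, smul_sub, Finset.sum_sub_distrib, smul_smul, ← Finset.sum_smul]
      congr 2
      rw [hg]
      simp only [← mul_div_assoc, ← Finset.sum_div]
      field_simp
    simp only [hD, hZ, e1, smul_sub, Finset.sum_sub_distrib]
    rw [traceFreePart]
    module
  have hZS : Z ∈ S := by
    have h1 : ∑ a, ∑ b, (gram B e')⁻¹ a b • D a b = 0 := by
      have h2 := sum_inv_smul_pullback hJ (traceFreePart B e A)
      simp only [Matrix.smul_apply, smul_assoc, ← Finset.smul_sum,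
        sum_inv_smul_traceFreePart hB he, smul_zero] at h2
      simp only [hD, smul_sub, Finset.sum_sub_distrib, sum_inv_smul_traceFreePart hB he' A',
        smul_comm _ τ, ← Finset.smul_sum, h2, smul_zero, sub_zero]
    have h3 : ∑ a, ∑ b, (gram B e')⁻¹ a b • (D a b + gram B e' a b • Z) ∈ S :=
      sum_mem fun a _ => sum_mem fun b _ => Submodule.smul_mem _ _ (hDZ a b)
    simp only [smul_add, Finset.sum_add_distrib, h1, zero_add, smul_smul, ← Finset.sum_smul] at h3
    rw [sum_inv_mul_self (gram_transpose hB e') (Matrix.nonsing_inv_mul _ he')] at h3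
    exact (S.smul_mem_iff hm).1 h3
  have hDS : D a b ∈ S := (S.add_mem_iff_left (S.smul_mem _ hZS)).1 (hDZ a b)
  have hJu : IsUnit J := by
    refine isUnit_of_mul_isUnit_left (y := (gram B e')⁻¹ * Jᵀ) ?_
    rw [← Matrix.mul_assoc, hJ]
    refine IsUnit.smul (Units.mk0 _ (inv_ne_zero (pow_ne_zero 2 hτ))) ?_
    exact (Matrix.isUnit_nonsing_inv_iff).2 ((Matrix.isUnit_iff_isUnit_det _).2 he)
  have hDe : ∀ l, B (D a b) (e l) = 0 := by
    have h0 : (fun i => B (D a b) (e i)) ᵥ* J = 0 := by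
      ext l
      have h1 : B (D a b) (e' l) = 0 := by
        have h2 := apply_traceFreePart_position hB he heX hAX
        have h4 : ∀ i j, B (traceFreePart B e A i j) (e' l) = 0 := fun i j => by
          simp [hee, h2, apply_traceFreePart hB he]
        simp [hD, h4, sum_apply, apply_traceFreePart hB he']
      rw [hee, map_add, map_smul, map_smul, hDX, smul_zero, add_zero] at h1
      have h2 := (smul_eq_zero.1 h1).resolve_left hτ
      rw [Pi.zero_apply, ← h2]
      simp only [Matrix.vecMul, dotProduct, map_sum, map_smul, smul_eq_mul, mul_comm]
    intro l
    have h1 := Matrix.vecMul_injective_of_isUnit hJu (h0.trans (Matrix.zero_vecMul J).symm)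
    exact congrFun h1 l
  obtain ⟨s, hs⟩ := mem_span_singleton_of_orthogonal hB he heX hDS hDe
  exact ⟨s, by rw [← hs]; simp [hD]⟩

/-- The inverse of the pulled back metric, without inverting `J`, whose invertibility is a
consequence of the nondegeneracy of the pulled back metric. -/
theorem inv_gram_pullback {e e' : ι → V} {τ : ℝ} {J : Matrix ι ι ℝ}
    (he' : IsUnit (gram B e').det) (hτ : τ ≠ 0)
    (hg : ∀ a b, gram B e' a b = τ ^ 2 * ∑ i, ∑ j, (J i a * J j b) * gram B e i j) :
    J * (gram B e')⁻¹ * Jᵀ = (τ ^ 2)⁻¹ • (gram B e)⁻¹ := by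
  have hg' : gram B e' = Jᵀ * (τ ^ 2 • gram B e * J) := by
    ext a b
    rw [hg, Matrix.mul_apply, Finset.mul_sum]
    refine Finset.sum_congr rfl fun i _ => ?_
    rw [Matrix.mul_apply, Finset.mul_sum, Finset.mul_sum]
    refine Finset.sum_congr rfl fun j _ => ?_
    rw [Matrix.transpose_apply, Matrix.smul_apply, smul_eq_mul]
    ring
  have h1 : Jᵀ * (τ ^ 2 • gram B e * J * (gram B e')⁻¹) = 1 := by
    rw [← Matrix.mul_assoc, ← hg', Matrix.mul_nonsing_inv _ he']
  have h2 := mul_eq_one_comm.1 h1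
  have h3 : gram B e * (τ ^ 2 • (J * (gram B e')⁻¹ * Jᵀ)) = 1 := by
    rw [← h2]
    simp only [Matrix.smul_mul, Matrix.mul_smul, Matrix.mul_assoc]
  rw [Matrix.inv_eq_right_inv h3, smul_smul, inv_mul_cancel₀ (pow_ne_zero 2 hτ), one_smul]

theorem contraction_traceFreePart_pullback [Nonempty ι] (hB : ∀ v w, B v w = B w v) {X : V}
    (hX : B X X = 0) {e e' : ι → V} {A A' : ι → ι → V} {τ : ℝ} {J : Matrix ι ι ℝ} {c : ι → ℝ}
    (he : IsUnit (gram B e).det) (he' : IsUnit (gram B e').det)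
    (heX : ∀ i, B (e i) X = 0) (hAX : ∀ i j, B (A i j) X = - gram B e i j)
    (hAX' : ∀ i j, B (A' i j) (τ • X) = - gram B e' i j)
    (hτ : τ ≠ 0) (hee : ∀ a, e' a = τ • ∑ i, J i a • e i + c a • X)
    (hAA : ∀ a b, A' a b - τ • ∑ i, ∑ j, (J i a * J j b) • A i j ∈
      Submodule.span ℝ (insert X (Set.range e))) :
    contraction B (gram B e')⁻¹ (traceFreePart B e' A') (traceFreePart B e' A') =
      (τ ^ 2)⁻¹ * contraction B (gram B e)⁻¹ (traceFreePart B e A) (traceFreePart B e A) := by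
  have hg := gram_pullback hB hX heX hee
  have hJ := inv_gram_pullback he' hτ hg
  choose s hs using exists_traceFreePart_eq hB hX he he' heX hAX hAX' hτ hee hJ hg hAA
  have h1 := apply_traceFreePart_position hB he heX hAX
  have h2 : ∀ a b c d, B (traceFreePart B e' A' a b) (traceFreePart B e' A' c d) =
      τ ^ 2 * B (∑ i, ∑ j, (J i a * J j b) • traceFreePart B e A i j)
        (∑ i, ∑ j, (J i c * J j d) • traceFreePart B e A i j) := by
    intro a b c d
    have h3 : ∀ a b, B (∑ i, ∑ j, (J i a * J j b) • traceFreePart B e A i j) X = 0 := by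
      intro a b
      simp [sum_apply, h1]
    rw [hs, hs]
    simp only [map_add, map_smul, add_apply, smul_apply, h3, hX, hB X, smul_eq_mul]
    ring
  have h4 := contraction_pullback (B := B) hJ (traceFreePart B e A) (traceFreePart B e A)
  have h5 : contraction B (gram B e')⁻¹ (traceFreePart B e' A') (traceFreePart B e' A') =
      τ ^ 2 * contraction B ((τ ^ 2)⁻¹ • (gram B e)⁻¹) (traceFreePart B e A)
        (traceFreePart B e A) := by
    rw [← h4]
    simp only [contraction, h2, Finset.mul_sum]
    refine Finset.sum_congr rfl fun _ _ => Finset.sum_congr rfl fun _ _ =>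
      Finset.sum_congr rfl fun _ _ => Finset.sum_congr rfl fun _ _ => by ring
  rw [h5]
  simp only [contraction, Matrix.smul_apply, smul_eq_mul, Finset.mul_sum]
  refine Finset.sum_congr rfl fun _ _ => Finset.sum_congr rfl fun _ _ =>
    Finset.sum_congr rfl fun _ _ => Finset.sum_congr rfl fun _ _ => ?_
  field_simp

end ChangeOfFrame

/-! ### Partial derivatives, Christoffel symbols and the Laplacian -/

section Calculus
open Filter Topology

theorem lor_comm (n p : ℕ) (X Y : Amb n) : lor n p X Y = lor n p Y X := by
  simp only [lor_apply, mul_comm (X _)]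

variable {m : ℕ} {W : Type*} [NormedAddCommGroup W] [NormedSpace ℝ W]
  {f : EuclideanSpace ℝ (Fin m) → W} {u : EuclideanSpace ℝ (Fin m)}

theorem contDiffAt_pd (hf : ContDiffAt ℝ ∞ f u) (i : Fin m) : ContDiffAt ℝ ∞ (pd i f) u :=
  (hf.fderiv_right (m := ∞) (by simp)).clm_apply contDiffAt_const

theorem differentiableAt_of_contDiffAt (hf : ContDiffAt ℝ ∞ f u) : DifferentiableAt ℝ f u :=
  hf.differentiableAt (by simp)

theorem pd_congr {f₁ f₂ : EuclideanSpace ℝ (Fin m) → W} (h : f₁ =ᶠ[𝓝 u] f₂) (i : Fin m) :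
    pd i f₁ u = pd i f₂ u := by
  rw [pd, pd, h.fderiv_eq]

theorem pd_eventuallyEq {f₁ f₂ : EuclideanSpace ℝ (Fin m) → W} (h : f₁ =ᶠ[𝓝 u] f₂) (i : Fin m) :
    pd i f₁ =ᶠ[𝓝 u] pd i f₂ := by
  filter_upwards [h.eventuallyEq_nhds] with v hv using pd_congr hv i

theorem pd_comm (hf : ContDiffAt ℝ ∞ f u) (i j : Fin m) :
    pd i (pd j f) u = pd j (pd i f) u := by
  have h : ∀ i j : Fin m, pd i (pd j f) u = fderiv ℝ (fderiv ℝ f) u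
      (EuclideanSpace.single i 1) (EuclideanSpace.single j 1) := by
    intro i j
    have h1 : DifferentiableAt ℝ (fderiv ℝ f) u :=
      (hf.fderiv_right (m := ∞) (by simp)).differentiableAt (by simp)
    unfold pd
    rw [fderiv_clm_apply h1 (differentiableAt_const _)]
    simp
  rw [h, h]
  refine hf.isSymmSndFDerivAt ?_ _ _
  rw [minSmoothness_of_isRCLikeNormedField]
  exact WithTop.coe_le_coe.2 (le_top : (2 : ℕ∞) ≤ ⊤)

theorem pd_bilinear {V : Type*} [NormedAddCommGroup V] [NormedSpace ℝ V] (B : V →L[ℝ] V →L[ℝ] W)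
    {f₁ f₂ : EuclideanSpace ℝ (Fin m) → V} (h₁ : DifferentiableAt ℝ f₁ u)
    (h₂ : DifferentiableAt ℝ f₂ u) (i : Fin m) :
    pd i (fun v => B (f₁ v) (f₂ v)) u = B (pd i f₁ u) (f₂ u) + B (f₁ u) (pd i f₂ u) := by
  have h := B.hasFDerivAt_of_bilinear h₁.hasFDerivAt h₂.hasFDerivAt
  simp only [pd, h.fderiv]
  simp [add_comm]

theorem pd_smul {s : EuclideanSpace ℝ (Fin m) → ℝ} (hs : DifferentiableAt ℝ s u)
    (hf : DifferentiableAt ℝ f u) (i : Fin m) :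
    pd i (fun v => s v • f v) u = s u • pd i f u + pd i s u • f u := by
  simp only [pd, fderiv_fun_smul hs hf]
  simp

theorem pd_sum {ι : Type*} {s : Finset ι} {f : ι → EuclideanSpace ℝ (Fin m) → W}
    (hf : ∀ j ∈ s, DifferentiableAt ℝ (f j) u) (i : Fin m) :
    pd i (fun v => ∑ j ∈ s, f j v) u = ∑ j ∈ s, pd i (f j) u := by
  simp only [pd, fderiv_fun_sum hf, sum_apply]

theorem pd_add {f₁ f₂ : EuclideanSpace ℝ (Fin m) → W} (h₁ : DifferentiableAt ℝ f₁ u)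
    (h₂ : DifferentiableAt ℝ f₂ u) (i : Fin m) :
    pd i (fun v => f₁ v + f₂ v) u = pd i f₁ u + pd i f₂ u := by
  simp only [pd, fderiv_fun_add h₁ h₂, add_apply]

theorem pd_comp {ψ : EuclideanSpace ℝ (Fin m) → EuclideanSpace ℝ (Fin m)}
    (hf : DifferentiableAt ℝ f (ψ u)) (hψ : DifferentiableAt ℝ ψ u) (a : Fin m) :
    pd a (fun v => f (ψ v)) u = ∑ i, pd a ψ u i • pd i f (ψ u) := by
  have h : pd a ψ u = ∑ i, pd a ψ u i • EuclideanSpace.single i (1 : ℝ) := by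
    ext j
    simp [Finset.sum_apply, Pi.single_apply]
  have h1 : pd a (fun v => f (ψ v)) u = fderiv ℝ f (ψ u) (pd a ψ u) := by
    have := fderiv_comp u hf hψ
    simp only [pd]
    rw [show (fun v => f (ψ v)) = f ∘ ψ from rfl, this]
    rfl
  rw [h1]
  conv_lhs => rw [h]
  simp [map_sum, pd]

variable {n p : ℕ} {F : EuclideanSpace ℝ (Fin m) → Amb n}

theorem pd_inducedMatrix (hF : ContDiffAt ℝ ∞ F u) (i j k : Fin m) :
    pd i (fun v => inducedMatrix n p F v j k) u =
      lor n p (pd i (pd j F) u) (pd k F u) + lor n p (pd j F u) (pd i (pd k F) u) :=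
  pd_bilinear (lor n p) (differentiableAt_of_contDiffAt (contDiffAt_pd hF j))
    (differentiableAt_of_contDiffAt (contDiffAt_pd hF k)) i

theorem inducedMatrix_eq_gram (n p : ℕ) (F : EuclideanSpace ℝ (Fin m) → Amb n)
    (u : EuclideanSpace ℝ (Fin m)) :
    inducedMatrix n p F u = gram (lor n p) fun i => pd i F u := rfl

/-- The Christoffel symbols of an induced metric are the tangential components of the second
derivatives. -/
theorem christoffel_inducedMatrix (hF : ContDiffAt ℝ ∞ F u) (k i j : Fin m) :
    christoffel (inducedMatrix n p F) k i j u =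
      ∑ l, (gram (lor n p) fun i => pd i F u)⁻¹ k l * lor n p (pd i (pd j F) u) (pd l F u) := by
  rw [christoffel, Finset.mul_sum]
  refine Finset.sum_congr rfl fun l _ => ?_
  rw [pd_inducedMatrix hF, pd_inducedMatrix hF, pd_inducedMatrix hF, inducedMatrix_eq_gram,
    pd_comm hF j i, pd_comm hF l i, pd_comm hF l j, lor_comm n p (pd j F u), lor_comm n p (pd i F u)
      (pd j (pd l F) u)]
  ring

theorem normalPart_pd_pd (hF : ContDiffAt ℝ ∞ F u) (i j : Fin m) :
    pd i (pd j F) u - ∑ k, christoffel (inducedMatrix n p F) k i j u • pd k F u =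
      normalPart (lor n p) (fun i => pd i F u) (pd i (pd j F) u) := by
  simp only [normalPart, christoffel_inducedMatrix hF]

theorem laplacian_inducedMatrix (hF : ContDiffAt ℝ ∞ F u) :
    laplacian (inducedMatrix n p F) F u =
      normalTrace (lor n p) (fun i => pd i F u) (fun i j => pd i (pd j F) u) := by
  simp only [laplacian, normalTrace, normalPart_pd_pd hF]
  rfl

theorem contDiffAt_det {ι : Type*} [Fintype ι] [DecidableEq ι]
    {G : EuclideanSpace ℝ (Fin m) → Matrix ι ι ℝ}
    (hG : ∀ i j, ContDiffAt ℝ ∞ (fun v => G v i j) u) : ContDiffAt ℝ ∞ (fun v => (G v).det) u := by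
  simp only [Matrix.det_apply]
  exact ContDiffAt.sum fun σ _ => ContDiffAt.const_smul _ (contDiffAt_prod fun i _ => hG _ _)

theorem contDiffAt_matrix_inv {ι : Type*} [Fintype ι] [DecidableEq ι]
    {G : EuclideanSpace ℝ (Fin m) → Matrix ι ι ℝ}
    (hG : ∀ i j, ContDiffAt ℝ ∞ (fun v => G v i j) u) (hu : IsUnit (G u).det) (i j : ι) :
    ContDiffAt ℝ ∞ (fun v => (G v)⁻¹ i j) u := by
  simp only [Matrix.inv_def, Matrix.smul_apply, Ring.inverse_eq_inv', Matrix.adjugate_apply,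
    smul_eq_mul]
  refine ((contDiffAt_det hG).inv hu.ne_zero).mul (contDiffAt_det fun k l => ?_)
  by_cases hk : k = j
  · subst hk
    simpa only [Matrix.updateRow_self] using contDiffAt_const
  · simpa only [Matrix.updateRow_ne hk] using hG k l

theorem contDiffAt_inducedMatrix (hF : ContDiffAt ℝ ∞ F u) (i j : Fin m) :
    ContDiffAt ℝ ∞ (fun v => inducedMatrix n p F v i j) u :=
  ((lor n p).contDiff.contDiffAt.comp u (contDiffAt_pd hF i)).clm_apply (contDiffAt_pd hF j)

theorem contDiffAt_christoffel {G : EuclideanSpace ℝ (Fin m) → Matrix (Fin m) (Fin m) ℝ}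
    (hG : ∀ i j, ContDiffAt ℝ ∞ (fun v => G v i j) u) (hu : IsUnit (G u).det) (k i j : Fin m) :
    ContDiffAt ℝ ∞ (christoffel G k i j) u := by
  unfold christoffel
  exact contDiffAt_const.mul (ContDiffAt.sum fun l _ => (contDiffAt_matrix_inv hG hu k l).mul
    (((contDiffAt_pd (hG _ _) _).add (contDiffAt_pd (hG _ _) _)).sub (contDiffAt_pd (hG _ _) _)))

end Calculus

/-! ### The Gauss equation -/

section Gauss
open Filter Topology
variable {m n p : ℕ} {F : EuclideanSpace ℝ (Fin m) → Amb n} {u : EuclideanSpace ℝ (Fin m)}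

theorem sum_inducedMatrix_mul_christoffel (hF : ContDiffAt ℝ ∞ F u)
    (hu : IsUnit (inducedMatrix n p F u).det) (l i j : Fin m) :
    ∑ r, inducedMatrix n p F u l r * christoffel (inducedMatrix n p F) r i j u =
      lor n p (pd i (pd j F) u) (pd l F u) := by
  have h := apply_normalPart (lor_comm n p) (e := fun i => pd i F u) hu (pd i (pd j F) u) l
  rw [← normalPart_pd_pd hF, map_sub, sub_apply, sub_eq_zero] at h
  rw [h]
  simp only [map_sum, map_smul, sum_apply, smul_apply, smul_eq_mul]
  refine Finset.sum_congr rfl fun r _ => ?_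
  rw [mul_comm, lor_comm]
  rfl

theorem eventually_isUnit_det (hF : ContDiffAt ℝ ∞ F u)
    (hu : IsUnit (inducedMatrix n p F u).det) :
    ∀ᶠ v in 𝓝 u, IsUnit (inducedMatrix n p F v).det := by
  have h := (contDiffAt_det (contDiffAt_inducedMatrix (p := p) hF)).continuousAt
  filter_upwards [h.eventually_ne hu.ne_zero] with v hv using isUnit_iff_ne_zero.2 hv

/-- The derivative of `∑_r g_{lr} Γ^r_{jk} = ⟨∂_j ∂_k F, ∂_l F⟩`, which gives the derivatives of the
Christoffel symbols without differentiating the inverse matrix. -/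
theorem sum_inducedMatrix_mul_pd_christoffel (hF : ∀ᶠ v in 𝓝 u, ContDiffAt ℝ ∞ F v)
    (hu : IsUnit (inducedMatrix n p F u).det) (l i j k : Fin m) :
    ∑ r, inducedMatrix n p F u l r * pd i (christoffel (inducedMatrix n p F) r j k) u =
      lor n p (pd i (pd j (pd k F)) u) (pd l F u) +
        lor n p (pd j (pd k F) u) (pd i (pd l F) u) -
      ∑ r, (lor n p (pd i (pd l F) u) (pd r F u) + lor n p (pd l F u) (pd i (pd r F) u)) *
        christoffel (inducedMatrix n p F) r j k u := by
  have hFu := hF.self_of_nhds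
  have h1 : (fun v => ∑ r, inducedMatrix n p F v l r *
      christoffel (inducedMatrix n p F) r j k v) =ᶠ[𝓝 u]
      fun v => lor n p (pd j (pd k F) v) (pd l F v) := by
    filter_upwards [hF, eventually_isUnit_det hFu hu] with v hv hv'
      using sum_inducedMatrix_mul_christoffel hv hv' l j k
  have hG := fun r => differentiableAt_of_contDiffAt (contDiffAt_inducedMatrix (p := p) hFu l r)
  have hΓ := fun r => differentiableAt_of_contDiffAt
    (contDiffAt_christoffel (contDiffAt_inducedMatrix (p := p) hFu) hu r j k)
  have h2 := pd_congr h1 i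
  rw [pd_bilinear (lor n p)
    (differentiableAt_of_contDiffAt (contDiffAt_pd (contDiffAt_pd hFu k) j))
    (differentiableAt_of_contDiffAt (contDiffAt_pd hFu l)), pd_sum
      (f := fun r v => inducedMatrix n p F v l r * christoffel (inducedMatrix n p F) r j k v)
      (fun r _ => (hG r).mul (hΓ r))] at h2
  have h3 : ∀ r, pd i (fun v => inducedMatrix n p F v l r *
      christoffel (inducedMatrix n p F) r j k v) u =
      inducedMatrix n p F u l r * pd i (christoffel (inducedMatrix n p F) r j k) u +
      (lor n p (pd i (pd l F) u) (pd r F u) + lor n p (pd l F u) (pd i (pd r F) u)) *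
        christoffel (inducedMatrix n p F) r j k u := by
    intro r
    rw [← pd_inducedMatrix hFu]
    exact pd_smul (hG r) (hΓ r) i
  simp only [h3, Finset.sum_add_distrib] at h2
  rw [← h2]
  ring

/-- The Gauss equation: the curvature tensor of the induced metric in terms of the normal parts of
the second derivatives. -/
theorem sum_inducedMatrix_mul_riemann (hF : ∀ᶠ v in 𝓝 u, ContDiffAt ℝ ∞ F v)
    (hu : IsUnit (inducedMatrix n p F u).det) (l k i j : Fin m) :
    ∑ r, inducedMatrix n p F u l r * riemann (inducedMatrix n p F) r k i j u =
      lor n p (normalPart (lor n p) (fun i => pd i F u) (pd i (pd l F) u))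
        (normalPart (lor n p) (fun i => pd i F u) (pd j (pd k F) u)) -
      lor n p (normalPart (lor n p) (fun i => pd i F u) (pd j (pd l F) u))
        (normalPart (lor n p) (fun i => pd i F u) (pd i (pd k F) u)) := by
  have hFu := hF.self_of_nhds
  have hN : ∀ a b c d : Fin m,
      lor n p (normalPart (lor n p) (fun i => pd i F u) (pd a (pd b F) u))
        (normalPart (lor n p) (fun i => pd i F u) (pd c (pd d F) u)) =
      lor n p (pd a (pd b F) u) (pd c (pd d F) u) -
        ∑ r, lor n p (pd a (pd b F) u) (pd r F u) *
          christoffel (inducedMatrix n p F) r c d u := by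
    intro a b c d
    have h1 := apply_normalPart (lor_comm n p) (e := fun i => pd i F u) hu (pd c (pd d F) u)
    have h2 : normalPart (lor n p) (fun i => pd i F u) (pd a (pd b F) u) = pd a (pd b F) u -
        ∑ k, christoffel (inducedMatrix n p F) k a b u • pd k F u := (normalPart_pd_pd hFu a b).symm
    rw [h2, map_sub, sub_apply, map_sum, sum_apply]
    simp only [map_smul, smul_apply, lor_comm n p (pd _ F u), h1, smul_zero,
      Finset.sum_const_zero, sub_zero]
    rw [← normalPart_pd_pd hFu, map_sub]
    simp only [map_sum, map_smul, smul_eq_mul, mul_comm]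
  have hq : ∀ a b c d : Fin m, ∑ r, inducedMatrix n p F u l r *
      ∑ s, (christoffel (inducedMatrix n p F) r a s u * christoffel (inducedMatrix n p F) s b c u) =
      ∑ s, lor n p (pd l F u) (pd a (pd s F) u) * christoffel (inducedMatrix n p F) s b c u := by
    intro a b c d
    simp only [Finset.mul_sum, ← mul_assoc]
    rw [Finset.sum_comm]
    simp only [← Finset.sum_mul, sum_inducedMatrix_mul_christoffel hFu hu, lor_comm n p (pd l F u)]
  have h3 : pd i (pd j (pd k F)) u = pd j (pd i (pd k F)) u := pd_comm (contDiffAt_pd hFu k) i j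
  simp only [riemann, Finset.sum_sub_distrib, mul_add, mul_sub, Finset.sum_add_distrib, hq _ _ _ k,
    sum_inducedMatrix_mul_pd_christoffel hF hu, hN, h3, add_mul,
    lor_comm n p (pd j (pd k F) u) (pd i (pd l F) u),
    lor_comm n p (pd i (pd k F) u) (pd j (pd l F) u)]
  ring

theorem riemann_inducedMatrix (hF : ∀ᶠ v in 𝓝 u, ContDiffAt ℝ ∞ F v)
    (hu : IsUnit (inducedMatrix n p F u).det) (r k i j : Fin m) :
    riemann (inducedMatrix n p F) r k i j u = ∑ l, (inducedMatrix n p F u)⁻¹ r l *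
      (lor n p (normalPart (lor n p) (fun i => pd i F u) (pd i (pd l F) u))
        (normalPart (lor n p) (fun i => pd i F u) (pd j (pd k F) u)) -
      lor n p (normalPart (lor n p) (fun i => pd i F u) (pd j (pd l F) u))
        (normalPart (lor n p) (fun i => pd i F u) (pd i (pd k F) u))) := by
  simp only [← sum_inducedMatrix_mul_riemann hF hu]
  have h : (inducedMatrix n p F u)⁻¹ *ᵥ ((inducedMatrix n p F u) *ᵥ
      fun r => riemann (inducedMatrix n p F) r k i j u) =
      fun r => riemann (inducedMatrix n p F) r k i j u := by
    rw [Matrix.mulVec_mulVec, Matrix.nonsing_inv_mul _ hu, Matrix.one_mulVec]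
  exact (congrFun h r).symm

/-- The function `⟨ΔF, ΔF⟩ - m² κ` of the metric `⟨dF, dF⟩` of a map given in coordinates. -/
def coordFactor (n p : ℕ) (F : EuclideanSpace ℝ (Fin m) → Amb n) (u : EuclideanSpace ℝ (Fin m)) :
    ℝ :=
  lor n p (laplacian (inducedMatrix n p F) F u) (laplacian (inducedMatrix n p F) F u) -
    (m : ℝ) ^ 2 * normScalarCurvature (inducedMatrix n p F) u

/-- The factor is, up to a constant, the squared length of the trace-free second fundamental
form. -/
theorem coordFactor_eq (hm : 2 ≤ m) (hF : ∀ᶠ v in 𝓝 u, ContDiffAt ℝ ∞ F v)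
    (hu : IsUnit (inducedMatrix n p F u).det) :
    coordFactor n p F u = (m / (m - 1) : ℝ) *
      contraction (lor n p) (inducedMatrix n p F u)⁻¹
        (traceFreePart (lor n p) (fun i => pd i F u) fun i j => pd i (pd j F) u)
        (traceFreePart (lor n p) (fun i => pd i F u) fun i j => pd i (pd j F) u) := by
  have hFu := hF.self_of_nhds
  have : Nonempty (Fin m) := ⟨⟨0, by omega⟩⟩
  have hm0 : (m : ℝ) ≠ 0 := by positivity
  have hm1 : (m : ℝ) - 1 ≠ 0 := by
    have : (2 : ℝ) ≤ m := by exact_mod_cast hm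
    linarith
  have h1 := contraction_traceFreePart (lor_comm n p) (e := fun i => pd i F u) hu
    fun i j => pd i (pd j F) u
  rw [inducedMatrix_eq_gram, h1, coordFactor, laplacian_inducedMatrix hFu, normScalarCurvature]
  have h2 : ∑ k, ∑ j, (inducedMatrix n p F u)⁻¹ k j * ricci (inducedMatrix n p F) k j u =
      lor n p (normalTrace (lor n p) (fun i => pd i F u) fun i j => pd i (pd j F) u)
        (normalTrace (lor n p) (fun i => pd i F u) fun i j => pd i (pd j F) u) -
      contraction (lor n p) (inducedMatrix n p F u)⁻¹
        (fun i j => normalPart (lor n p) (fun i => pd i F u) (pd i (pd j F) u))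
        (fun i j => normalPart (lor n p) (fun i => pd i F u) (pd i (pd j F) u)) := by
    simp only [ricci, riemann_inducedMatrix hF hu]
    exact sum_mul_sum_mul_sub (lor_comm n p) _ fun i j => by rw [pd_comm hFu]
  rw [h2, inducedMatrix_eq_gram, Fintype.card_fin]
  field_simp
  ring

end Gauss

/-! ### Change of lift and of coordinates -/

section Change
open Filter Topology
variable {m n p : ℕ} {F F' : EuclideanSpace ℝ (Fin m) → Amb n}
  {ψ : EuclideanSpace ℝ (Fin m) → EuclideanSpace ℝ (Fin m)} {τ : EuclideanSpace ℝ (Fin m) → ℝ}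
  {u : EuclideanSpace ℝ (Fin m)}

theorem lor_pd_self (hF : ContDiffAt ℝ ∞ F u) (h0 : ∀ᶠ v in 𝓝 u, lor n p (F v) (F v) = 0)
    (i : Fin m) : lor n p (pd i F u) (F u) = 0 := by
  have hd := differentiableAt_of_contDiffAt hF
  have h1 := pd_bilinear (lor n p) hd hd i
  have h2 : pd i (fun v => lor n p (F v) (F v)) u = 0 := by
    rw [pd_congr (f₂ := fun _ => (0 : ℝ)) h0]
    simp [pd]
  rw [h2, lor_comm n p (F u)] at h1
  linarith

theorem lor_pd_pd_self (hF : ∀ᶠ v in 𝓝 u, ContDiffAt ℝ ∞ F v)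
    (h0 : ∀ᶠ v in 𝓝 u, lor n p (F v) (F v) = 0) (i j : Fin m) :
    lor n p (pd i (pd j F) u) (F u) = - lor n p (pd i F u) (pd j F u) := by
  have hFu := hF.self_of_nhds
  have h1 := pd_bilinear (lor n p) (differentiableAt_of_contDiffAt (contDiffAt_pd hFu j))
    (differentiableAt_of_contDiffAt hFu) i
  have h2 : pd i (fun v => lor n p (pd j F v) (F v)) u = 0 := by
    rw [pd_congr (f₂ := fun _ => (0 : ℝ))]
    · simp [pd]
    · filter_upwards [hF, h0.eventually_nhds] with v hv hv' using lor_pd_self hv hv' j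
  rw [h2, lor_comm n p (pd j F u)] at h1
  linarith

theorem pd_smul_comp (hF : ContDiffAt ℝ ∞ F (ψ u)) (hψ : ContDiffAt ℝ ∞ ψ u)
    (hτ : ContDiffAt ℝ ∞ τ u) (a : Fin m) :
    pd a (fun v => τ v • F (ψ v)) u =
      τ u • ∑ i, pd a ψ u i • pd i F (ψ u) + pd a τ u • F (ψ u) := by
  rw [pd_smul (f := fun v => F (ψ v)) (differentiableAt_of_contDiffAt hτ)
    (differentiableAt_of_contDiffAt (hF.comp u hψ)),
    pd_comp (differentiableAt_of_contDiffAt hF) (differentiableAt_of_contDiffAt hψ)]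

/-- The second derivatives of `τ • (F ∘ ψ)` modulo the span of `F` and its first derivatives. -/
theorem pd_pd_smul_comp_sub_mem (hF : ∀ᶠ v in 𝓝 (ψ u), ContDiffAt ℝ ∞ F v)
    (hψ : ∀ᶠ v in 𝓝 u, ContDiffAt ℝ ∞ ψ v) (hτ : ∀ᶠ v in 𝓝 u, ContDiffAt ℝ ∞ τ v) (a b : Fin m) :
    pd a (pd b fun v => τ v • F (ψ v)) u -
      τ u • ∑ i, ∑ j, (pd a ψ u i * pd b ψ u j) • pd i (pd j F) (ψ u) ∈
      Submodule.span ℝ (insert (F (ψ u)) (Set.range fun i => pd i F (ψ u))) := by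
  have hψu := hψ.self_of_nhds
  have hτu := hτ.self_of_nhds
  have hFu := hF.self_of_nhds
  have h1 : pd b (fun v => τ v • F (ψ v)) =ᶠ[𝓝 u] fun v =>
      τ v • ∑ j, pd b ψ v j • pd j F (ψ v) + pd b τ v • F (ψ v) := by
    filter_upwards [hψ, hτ, hψu.continuousAt.eventually hF] with v h1 h2 h3
      using pd_smul_comp h3 h1 h2 b
  have hψb : ∀ j, ContDiffAt ℝ ∞ (fun v => pd b ψ v j) u := fun j =>
    (EuclideanSpace.proj (𝕜 := ℝ) j).contDiff.contDiffAt.comp u (contDiffAt_pd hψu b)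
  have hFj : ∀ j, ContDiffAt ℝ ∞ (fun v => pd j F (ψ v)) u := fun j =>
    (contDiffAt_pd hFu j).comp u hψu
  have hj : ∀ j, ContDiffAt ℝ ∞ (fun v => pd b ψ v j • pd j F (ψ v)) u := fun j =>
    (hψb j).smul (hFj j)
  have hs : ContDiffAt ℝ ∞ (fun v => ∑ j, pd b ψ v j • pd j F (ψ v)) u :=
    ContDiffAt.sum fun j _ => hj j
  have hFψ : ContDiffAt ℝ ∞ (fun v => F (ψ v)) u := hFu.comp u hψu
  have hd {W : Type} [NormedAddCommGroup W] [NormedSpace ℝ W]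
    {f : EuclideanSpace ℝ (Fin m) → W} (h : ContDiffAt ℝ ∞ f u) := differentiableAt_of_contDiffAt h
  rw [pd_congr h1, pd_add (f₁ := fun v => τ v • ∑ j, pd b ψ v j • pd j F (ψ v))
      (f₂ := fun v => pd b τ v • F (ψ v)) (hd (hτu.smul hs)) (hd ((contDiffAt_pd hτu b).smul hFψ)),
    pd_smul (hd hτu) (hd hs), pd_smul (hd (contDiffAt_pd hτu b)) (hd hFψ),
    pd_sum (f := fun j v => pd b ψ v j • pd j F (ψ v)) (fun j _ => hd (hj j)),
    pd_comp (differentiableAt_of_contDiffAt hFu) (hd hψu)]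
  have h2 : ∀ j, pd a (fun v => pd b ψ v j • pd j F (ψ v)) u =
      pd b ψ u j • ∑ i, pd a ψ u i • pd i (pd j F) (ψ u) +
        pd a (fun v => pd b ψ v j) u • pd j F (ψ u) := fun j => by
    rw [pd_smul (hd (hψb j)) (hd (hFj j)),
      pd_comp (differentiableAt_of_contDiffAt (contDiffAt_pd hFu j)) (hd hψu)]
  have h3 : ∑ i, ∑ j, (pd a ψ u i * pd b ψ u j) • pd i (pd j F) (ψ u) =
      ∑ j, pd b ψ u j • ∑ i, pd a ψ u i • pd i (pd j F) (ψ u) := by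
    rw [Finset.sum_comm]
    refine Finset.sum_congr rfl fun j _ => ?_
    rw [Finset.smul_sum]
    exact Finset.sum_congr rfl fun i _ => by rw [smul_smul, mul_comm]
  simp only [h2, h3, Finset.sum_add_distrib, smul_add]
  set S := Submodule.span ℝ (insert (F (ψ u)) (Set.range fun i => pd i F (ψ u))) with hS
  have hX : F (ψ u) ∈ S := Submodule.subset_span (Set.mem_insert _ _)
  have he : ∀ i, pd i F (ψ u) ∈ S := fun i =>
    Submodule.subset_span (Set.mem_insert_of_mem _ ⟨i, rfl⟩)
  have hsum : ∀ c : Fin m → ℝ, ∑ i, c i • pd i F (ψ u) ∈ S := fun c =>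
    sum_mem fun i _ => S.smul_mem _ (he i)
  have h4 := S.add_mem (S.add_mem (S.smul_mem (τ u) (hsum fun j => pd a (fun v => pd b ψ v j) u))
    (S.smul_mem (pd a τ u) (hsum fun j => pd b ψ u j)))
    (S.add_mem (S.smul_mem (pd b τ u) (hsum fun i => pd a ψ u i))
      (S.smul_mem (pd a (pd b τ) u) hX))
  convert h4 using 1
  abel

/-- Transformation of `⟨ΔF, ΔF⟩ - m² κ` under a change of the lift and of the coordinates. -/
theorem coordFactor_smul_comp (hm : 2 ≤ m) (hF : ∀ᶠ v in 𝓝 (ψ u), ContDiffAt ℝ ∞ F v)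
    (h0 : ∀ᶠ v in 𝓝 (ψ u), lor n p (F v) (F v) = 0)
    (hψ : ∀ᶠ v in 𝓝 u, ContDiffAt ℝ ∞ ψ v) (hτ : ∀ᶠ v in 𝓝 u, ContDiffAt ℝ ∞ τ v)
    (hτ0 : τ u ≠ 0) (hF' : F' =ᶠ[𝓝 u] fun v => τ v • F (ψ v))
    (hu : IsUnit (inducedMatrix n p F (ψ u)).det) (hu' : IsUnit (inducedMatrix n p F' u).det) :
    coordFactor n p F' u = (τ u ^ 2)⁻¹ * coordFactor n p F (ψ u) := by
  have hψu := hψ.self_of_nhds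
  have hτu := hτ.self_of_nhds
  have hFu := hF.self_of_nhds
  have : Nonempty (Fin m) := ⟨⟨0, by omega⟩⟩
  have hs' : ∀ᶠ v in 𝓝 u, ContDiffAt ℝ ∞ F' v := by
    filter_upwards [hψ, hτ, hψu.continuousAt.eventually hF, hF'.eventuallyEq_nhds]
      with v h1 h2 h3 h4 using (h2.smul (h3.comp v h1)).congr_of_eventuallyEq h4
  have h0' : ∀ᶠ v in 𝓝 u, lor n p (F' v) (F' v) = 0 := by
    filter_upwards [hψu.continuousAt.eventually h0, hF'] with v h1 h2
    rw [h2, map_smul, map_smul, smul_apply, h1, smul_zero, smul_zero]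
  rw [coordFactor_eq hm hF hu, coordFactor_eq hm hs' hu']
  have key := contraction_traceFreePart_pullback (B := lor n p) (lor_comm n p) (X := F (ψ u))
    (e := fun i => pd i F (ψ u)) (e' := fun i => pd i F' u)
    (A := fun i j => pd i (pd j F) (ψ u)) (A' := fun i j => pd i (pd j F') u) (τ := τ u)
    (J := Matrix.of fun i a => pd a ψ u i) (c := fun a => pd a τ u) h0.self_of_nhds hu hu'
    (lor_pd_self hFu h0) (lor_pd_pd_self hF h0)
    (by
      rw [show τ u • F (ψ u) = F' u from hF'.self_of_nhds.symm]
      exact lor_pd_pd_self hs' h0') hτ0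
    (fun a => by
      rw [pd_congr hF', pd_smul_comp hFu hψu hτu]
      rfl)
    (fun a b => by
      rw [pd_congr (pd_eventuallyEq hF' b) a]
      exact pd_pd_smul_comp_sub_mem hF hψ hτ a b)
  rw [inducedMatrix_eq_gram, inducedMatrix_eq_gram, key]
  ring

end Change

/-! ### Local lifts -/

section Lifts
open Filter Topology
theorem eventually_symm_of_eventually {H M : Type*} [TopologicalSpace H] [TopologicalSpace M]
    {φ : OpenPartialHomeomorph M H} {q : M} {P : M → Prop} (hq : q ∈ φ.source)
    (h : ∀ᶠ r in 𝓝 q, P r) : ∀ᶠ v in 𝓝 (φ q), P (φ.symm v) := by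
  have h1 : ContinuousAt φ.symm (φ q) := φ.symm.continuousAt (φ.map_source hq)
  refine h1.eventually ?_
  rwa [φ.left_inv hq]

variable {m n p : ℕ} {M : Type*} [TopologicalSpace M] [ChartedSpace (EuclideanSpace ℝ (Fin m)) M]
  {x : M → ConformalSpace n p} {U U' : Set M} {y y' : M → Amb n}
  {φ φ' : OpenPartialHomeomorph M (EuclideanSpace ℝ (Fin m))} {q : M}

theorem IsLocalLift.contMDiffAt (h : IsLocalLift m x U y) (hq : q ∈ U) :
    ContMDiffAt (𝓡 m) 𝓘(ℝ, Amb n) ∞ y q :=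
  h.2.1.contMDiffAt (h.1.mem_nhds hq)

theorem IsLocalLift.lor_self (h : IsLocalLift m x U y) (hq : q ∈ U) :
    lor n p (y q) (y q) = 0 := (h.2.2 q hq).1.1

theorem IsLocalLift.ne_zero (h : IsLocalLift m x U y) (hq : q ∈ U) : y q ≠ 0 := (h.2.2 q hq).1.2

theorem IsLocalLift.exists_smul_eq (h : IsLocalLift m x U y) (h' : IsLocalLift m x U' y')
    (hq : q ∈ U) (hq' : q ∈ U') : ∃ a : ℝ, y' q = a • y q := by
  obtain ⟨h1, h2⟩ := h.2.2 q hq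
  obtain ⟨h3, h4⟩ := h'.2.2 q hq'
  have h5 := congrArg Subtype.val (h4.trans h2.symm)
  obtain ⟨a, ha⟩ := (Projectivization.mk_eq_mk_iff' ℝ _ _ h3.2 h1.2).1 h5
  exact ⟨a, ha.symm⟩

/-- Two local lifts differ locally by a smooth function without zeros. -/
theorem IsLocalLift.exists_eventuallyEq_smul (h : IsLocalLift m x U y)
    (h' : IsLocalLift m x U' y') (hq : q ∈ U) (hq' : q ∈ U') :
    ∃ τ : M → ℝ, (∀ᶠ r in 𝓝 q, ContMDiffAt (𝓡 m) 𝓘(ℝ, ℝ) ∞ τ r) ∧ τ q ≠ 0 ∧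
      ∀ᶠ r in 𝓝 q, y' r = τ r • y r := by
  -- The factor is the quotient of the `i`-th coordinates, for an `i` with `y_i ≠ 0` at `q`.
  obtain ⟨i, hi⟩ := Function.ne_iff.1 (h.ne_zero hq)
  have hU := h.1.mem_nhds hq
  have hU' := h'.1.mem_nhds hq'
  have hcoord : ∀ {V : Set M} {z : M → Amb n} {r : M}, IsLocalLift m x V z → r ∈ V →
      ContMDiffAt (𝓡 m) 𝓘(ℝ, ℝ) ∞ (fun r => z r i) r := fun hz hr =>
    (contMDiffAt_pi_space.1 (hz.contMDiffAt hr)) i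
  have hne : ∀ᶠ r in 𝓝 q, y r i ≠ 0 := (hcoord h hq).continuousAt.eventually_ne hi
  have heq : ∀ᶠ r in 𝓝 q, y' r = (y' r i / y r i) • y r := by
    filter_upwards [hU, hU', hne] with r h1 h2 h3
    obtain ⟨a, ha⟩ := h.exists_smul_eq h' h1 h2
    have h4 : y' r i / y r i = a := by
      rw [ha, Pi.smul_apply, smul_eq_mul, mul_div_assoc, div_self h3, mul_one]
    rw [h4, ← ha]
  refine ⟨fun r => y' r i / y r i, ?_, ?_, heq⟩
  · filter_upwards [hU, hU', hne] with r h1 h2 h3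
    exact (hcoord h' h2).div₀ (hcoord h h1) h3
  · intro h0
    have h1 := heq.self_of_nhds
    simp only [h0, zero_smul] at h1
    exact h'.ne_zero hq' h1

theorem mdifferentiable_of_mem_maximalAtlas (hφ : φ ∈ IsManifold.maximalAtlas (𝓡 m) ∞ M) :
    φ.MDifferentiable (𝓡 m) (𝓡 m) :=
  ⟨(contMDiffOn_of_mem_maximalAtlas hφ).mdifferentiableOn (by simp),
    (contMDiffOn_symm_of_mem_maximalAtlas hφ).mdifferentiableOn (by simp)⟩

/-- A locally smooth map is smooth in the coordinates of the maximal atlas. -/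
theorem eventually_contDiffAt_comp_symm {W : Type*} [NormedAddCommGroup W] [NormedSpace ℝ W]
    {f : M → W} (hφ : φ ∈ IsManifold.maximalAtlas (𝓡 m) ∞ M) (hq : q ∈ φ.source)
    (hf : ∀ᶠ r in 𝓝 q, ContMDiffAt (𝓡 m) 𝓘(ℝ, W) ∞ f r) :
    ∀ᶠ v in 𝓝 (φ q), ContDiffAt ℝ ∞ (f ∘ φ.symm) v := by
  filter_upwards [eventually_symm_of_eventually hq hf,
    φ.open_target.mem_nhds (φ.map_source hq)] with v h1 h2
  exact (h1.comp v (contMDiffAt_symm_of_mem_maximalAtlas hφ h2)).contDiffAt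

theorem IsLocalLift.eventually_contDiffAt (h : IsLocalLift m x U y)
    (hφ : φ ∈ IsManifold.maximalAtlas (𝓡 m) ∞ M) (hq : q ∈ U ∩ φ.source) :
    ∀ᶠ v in 𝓝 (φ q), ContDiffAt ℝ ∞ (y ∘ φ.symm) v := by
  refine eventually_contDiffAt_comp_symm hφ hq.2 ?_
  filter_upwards [h.1.mem_nhds hq.1] with r hr using h.contMDiffAt hr

theorem IsLocalLift.eventually_lor_self (h : IsLocalLift m x U y) (hq : q ∈ U ∩ φ.source) :
    ∀ᶠ v in 𝓝 (φ q), lor n p ((y ∘ φ.symm) v) ((y ∘ φ.symm) v) = 0 := by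
  refine eventually_symm_of_eventually (P := fun r => lor n p (y r) (y r) = 0) hq.2 ?_
  filter_upwards [h.1.mem_nhds hq.1] with r hr using h.lor_self hr

/-- The form `⟨dy, dy⟩` in coordinates. -/
theorem inducedForm_apply_eq (hφ : φ ∈ IsManifold.maximalAtlas (𝓡 m) ∞ M) (hq : q ∈ φ.source)
    (hy : ContMDiffAt (𝓡 m) 𝓘(ℝ, Amb n) ∞ y q) (v w : TangentSpace (𝓡 m) q) :
    inducedForm m p y q v w =
      lor n p (fderiv ℝ (y ∘ φ.symm) (φ q) (mfderiv (𝓡 m) (𝓡 m) φ q v))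
        (fderiv ℝ (y ∘ φ.symm) (φ q) (mfderiv (𝓡 m) (𝓡 m) φ q w)) := by
  have hs : ContMDiffAt (𝓡 m) (𝓡 m) ∞ φ.symm (φ q) :=
    contMDiffAt_symm_of_mem_maximalAtlas hφ (φ.map_source hq)
  have hy' : ContMDiffAt (𝓡 m) 𝓘(ℝ, Amb n) ∞ y (φ.symm (φ q)) := by rwa [φ.left_inv hq]
  have hF : MDifferentiableAt (𝓡 m) 𝓘(ℝ, Amb n) (y ∘ φ.symm) (φ q) :=
    (hy'.comp _ hs).mdifferentiableAt (by simp)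
  have hφd := (mdifferentiable_of_mem_maximalAtlas hφ).mdifferentiableAt hq
  have h1 : mfderiv (𝓡 m) 𝓘(ℝ, Amb n) y q =
      (mfderiv (𝓡 m) 𝓘(ℝ, Amb n) (y ∘ φ.symm) (φ q)).comp (mfderiv (𝓡 m) (𝓡 m) φ q) := by
    rw [← mfderiv_comp q hF hφd]
    refine Filter.EventuallyEq.mfderiv_eq ?_
    filter_upwards [φ.open_source.mem_nhds hq] with r hr
    simp [φ.left_inv hr]
  rw [mfderiv_eq_fderiv] at h1
  simp only [inducedForm]
  rw [h1]
  rfl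

theorem isUnit_det_inducedMatrix (hφ : φ ∈ IsManifold.maximalAtlas (𝓡 m) ∞ M) (hq : q ∈ φ.source)
    (hy : ContMDiffAt (𝓡 m) 𝓘(ℝ, Amb n) ∞ y q) (h : NondegenerateAt m (inducedForm m p y q)) :
    IsUnit (inducedMatrix n p (y ∘ φ.symm) (φ q)).det := by
  rw [isUnit_iff_ne_zero]
  intro h0
  obtain ⟨c, hc, hcG⟩ := Matrix.exists_vecMul_eq_zero_iff.2 h0
  obtain ⟨v, hv⟩ := (mdifferentiable_of_mem_maximalAtlas hφ).mfderiv_surjective hq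
    (WithLp.toLp 2 c : EuclideanSpace ℝ (Fin m))
  have hsum : ∀ z : EuclideanSpace ℝ (Fin m), z = ∑ i, z i • EuclideanSpace.single i (1 : ℝ) := by
    intro z
    ext j
    simp [Finset.sum_apply, Pi.single_apply]
  have hfd : ∀ z : EuclideanSpace ℝ (Fin m),
      fderiv ℝ (y ∘ φ.symm) (φ q) z = ∑ i, z i • pd i (y ∘ φ.symm) (φ q) := by
    intro z
    conv_lhs => rw [hsum z]
    simp only [map_sum, map_smul, pd]
  have hz : ∀ z : EuclideanSpace ℝ (Fin m), lor n p
      (fderiv ℝ (y ∘ φ.symm) (φ q) (WithLp.toLp 2 c)) (fderiv ℝ (y ∘ φ.symm) (φ q) z) = 0 := by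
    intro z
    rw [hfd, hfd z, map_sum]
    refine Finset.sum_eq_zero fun j _ => ?_
    have h1 := congrFun hcG j
    simp only [Matrix.vecMul, dotProduct, inducedMatrix, Matrix.of_apply, Pi.zero_apply] at h1
    rw [map_smul, map_sum, sum_apply]
    simp only [map_smul, smul_apply, smul_eq_mul, h1, mul_zero]
  have hv0 : v = 0 := by
    refine h v fun w => ?_
    rw [inducedForm_apply_eq hφ hq hy, hv]
    exact hz _
  rw [hv0, map_zero] at hv
  exact hc (congrArg WithLp.ofLp hv.symm)

theorem lor_fderiv_self {F : EuclideanSpace ℝ (Fin m) → Amb n} {u : EuclideanSpace ℝ (Fin m)}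
    (hF : DifferentiableAt ℝ F u) (h0 : ∀ᶠ v in 𝓝 u, lor n p (F v) (F v) = 0)
    (z : EuclideanSpace ℝ (Fin m)) : lor n p (fderiv ℝ F u z) (F u) = 0 := by
  have h1 := ((lor n p).hasFDerivAt_of_bilinear hF.hasFDerivAt hF.hasFDerivAt).fderiv
  have h2 : fderiv ℝ (fun v => lor n p (F v) (F v)) u = 0 := by
    rw [Filter.EventuallyEq.fderiv_eq (f₁ := fun v => lor n p (F v) (F v)) (f := fun _ => 0) h0]
    simp
  rw [h2] at h1
  have h3 := congrArg (fun L => L z) h1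
  simp [lor_comm n p (F u)] at h3
  linarith

theorem lor_fderiv_smul {F : EuclideanSpace ℝ (Fin m) → Amb n} {u : EuclideanSpace ℝ (Fin m)}
    {τ : EuclideanSpace ℝ (Fin m) → ℝ} (hF : DifferentiableAt ℝ F u) (hτ : DifferentiableAt ℝ τ u)
    (h0 : ∀ᶠ v in 𝓝 u, lor n p (F v) (F v) = 0) (z w : EuclideanSpace ℝ (Fin m)) :
    lor n p (fderiv ℝ (fun v => τ v • F v) u z) (fderiv ℝ (fun v => τ v • F v) u w) =
      τ u ^ 2 * lor n p (fderiv ℝ F u z) (fderiv ℝ F u w) := by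
  have h1 := lor_fderiv_self hF h0
  have h2 : lor n p (F u) (F u) = 0 := h0.self_of_nhds
  rw [fderiv_fun_smul hτ hF]
  simp only [add_apply, smul_apply, ContinuousLinearMap.smulRight_apply, map_add, map_smul,
    smul_eq_mul, h1, h2, lor_comm n p (F u)]
  ring

variable [IsManifold (𝓡 m) ∞ M]

theorem inducedForm_smul {τ : M → ℝ} (hy : ContMDiffAt (𝓡 m) 𝓘(ℝ, Amb n) ∞ y q)
    (hτ : ContMDiffAt (𝓡 m) 𝓘(ℝ, ℝ) ∞ τ q) (h0 : ∀ᶠ r in 𝓝 q, lor n p (y r) (y r) = 0)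
    (h : ∀ᶠ r in 𝓝 q, y' r = τ r • y r) :
    inducedForm m p y' q = τ q ^ 2 • inducedForm m p y q := by
  set φ := chartAt (EuclideanSpace ℝ (Fin m)) q with hφdef
  have hφ : φ ∈ IsManifold.maximalAtlas (𝓡 m) ∞ M := IsManifold.chart_mem_maximalAtlas q
  have hq : q ∈ φ.source := mem_chart_source _ q
  have hs : ∀ {W : Type} [NormedAddCommGroup W] [NormedSpace ℝ W] {f : M → W},
      ContMDiffAt (𝓡 m) 𝓘(ℝ, W) ∞ f q → DifferentiableAt ℝ (f ∘ φ.symm) (φ q) := by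
    intro W _ _ f hf
    rw [← φ.left_inv hq] at hf
    exact differentiableAt_of_contDiffAt
      (hf.comp _ (contMDiffAt_symm_of_mem_maximalAtlas hφ (φ.map_source hq))).contDiffAt
  have hy' : ContMDiffAt (𝓡 m) 𝓘(ℝ, Amb n) ∞ y' q := (hτ.smul hy).congr_of_eventuallyEq h
  have h1 : y' ∘ φ.symm =ᶠ[𝓝 (φ q)] fun v => (τ ∘ φ.symm) v • (y ∘ φ.symm) v :=
    eventually_symm_of_eventually hq h
  ext v w
  rw [inducedForm_apply_eq hφ hq hy', h1.fderiv_eq]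
  refine (lor_fderiv_smul (p := p) (hs hy) (hs hτ) (eventually_symm_of_eventually
    (P := fun r => lor n p (y r) (y r) = 0) hq h0) _ _).trans ?_
  rw [← inducedForm_apply_eq hφ hq hy, Function.comp_apply, φ.left_inv hq]
  rfl

theorem IsLocalLift.nondegenerateAt (h : IsLocalLift m x U y) (h' : IsLocalLift m x U' y')
    (hq : q ∈ U) (hq' : q ∈ U') (hy : NondegenerateAt m (inducedForm m p y q)) :
    NondegenerateAt m (inducedForm m p y' q) := by
  obtain ⟨τ, hτ, hτ0, he⟩ := h.exists_eventuallyEq_smul h' hq hq'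
  rw [inducedForm_smul (h.contMDiffAt hq) hτ.self_of_nhds
    (by filter_upwards [h.1.mem_nhds hq] with r hr using h.lor_self hr) he]
  intro v hv
  refine hy v fun w => ?_
  exact (mul_eq_zero.1 (hv w)).resolve_left (pow_ne_zero 2 hτ0)

/-- The conformal form depends neither on the lift nor on the coordinates. -/
theorem conformalForm_eq (hm : 2 ≤ m) (ε : ℝ) (h : IsLocalLift m x U y)
    (h' : IsLocalLift m x U' y')
    (hφ : φ ∈ IsManifold.maximalAtlas (𝓡 m) ∞ M) (hφ' : φ' ∈ IsManifold.maximalAtlas (𝓡 m) ∞ M)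
    (hq : q ∈ U ∩ φ.source) (hq' : q ∈ U' ∩ φ'.source)
    (hy : NondegenerateAt m (inducedForm m p y q)) :
    conformalForm m p ε φ y q = conformalForm m p ε φ' y' q := by
  obtain ⟨τ, hτ, hτ0, he⟩ := h.exists_eventuallyEq_smul h' hq.1 hq'.1
  have hy' := h.nondegenerateAt h' hq.1 hq'.1 hy
  have e1 : φ'.symm (φ' q) = q := φ'.left_inv hq'.2
  have hψq : (φ ∘ φ'.symm) (φ' q) = φ q := congrArg φ e1
  have hc : conformalFactor m p φ' y' q = (τ q ^ 2)⁻¹ * conformalFactor m p φ y q := by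
    have key := coordFactor_smul_comp (n := n) (p := p) (F := y ∘ φ.symm) (F' := y' ∘ φ'.symm)
      (ψ := φ ∘ φ'.symm) (τ := τ ∘ φ'.symm) (u := φ' q) hm
      (by rw [hψq]; exact h.eventually_contDiffAt hφ hq)
      (by rw [hψq]; exact h.eventually_lor_self hq)
      (eventually_contDiffAt_comp_symm hφ' hq'.2 (by
        filter_upwards [φ.open_source.mem_nhds hq.2] with r hr
        exact contMDiffAt_of_mem_maximalAtlas hφ hr))
      (eventually_contDiffAt_comp_symm hφ' hq'.2 hτ)
      (by simpa only [Function.comp_apply, e1] using hτ0)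
      (by
        filter_upwards [eventually_symm_of_eventually hq'.2 he,
          eventually_symm_of_eventually hq'.2 (φ.open_source.mem_nhds hq.2)] with v h1 h2
        simp only [Function.comp_apply, h1]
        rw [φ.left_inv h2])
      (by rw [hψq]; exact isUnit_det_inducedMatrix hφ hq.2 (h.contMDiffAt hq.1) hy)
      (isUnit_det_inducedMatrix hφ' hq'.2 (h'.contMDiffAt hq'.1) hy')
    rw [hψq, Function.comp_apply, e1] at key
    exact key
  rw [conformalForm, conformalForm, hc, inducedForm_smul (h.contMDiffAt hq.1) hτ.self_of_nhds
    (by filter_upwards [h.1.mem_nhds hq.1] with r hr using h.lor_self hr) he, smul_smul]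
  congr 1
  field_simp

end Lifts

/-! ### Smoothness of the conformal 2-form -/

section Smooth
open Filter Topology
variable {m n p : ℕ} {F : EuclideanSpace ℝ (Fin m) → Amb n} {u : EuclideanSpace ℝ (Fin m)}

-- The norms on iterated spaces of continuous linear maps are found only at this depth.
set_option maxSynthPendingDepth 3 in
theorem contDiff_bilinearComp_self {E V : Type*} [NormedAddCommGroup E] [NormedSpace ℝ E]
    [NormedAddCommGroup V] [NormedSpace ℝ V] (B : V →L[ℝ] V →L[ℝ] ℝ) :
    ContDiff ℝ ∞ fun L : E →L[ℝ] V => B.bilinearComp L L := by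
  exact ((B.precompR E).precompL E).contDiff.clm_apply contDiff_id

theorem contDiffAt_normScalarCurvature {G : EuclideanSpace ℝ (Fin m) → Matrix (Fin m) (Fin m) ℝ}
    (hG : ∀ i j, ContDiffAt ℝ ∞ (fun v => G v i j) u) (hu : IsUnit (G u).det) :
    ContDiffAt ℝ ∞ (normScalarCurvature G) u := by
  have hΓ := contDiffAt_christoffel hG hu
  have hR : ∀ l k i j, ContDiffAt ℝ ∞ (riemann G l k i j) u := fun l k i j =>
    ((contDiffAt_pd (hΓ _ _ _) i).sub (contDiffAt_pd (hΓ _ _ _) j)).add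
      (ContDiffAt.sum fun a _ => ((hΓ _ _ _).mul (hΓ _ _ _)).sub ((hΓ _ _ _).mul (hΓ _ _ _)))
  exact (ContDiffAt.sum fun k _ => ContDiffAt.sum fun j _ => (contDiffAt_matrix_inv hG hu k j).mul
    (ContDiffAt.sum fun i _ => hR i k i j)).div_const _

theorem contDiffAt_laplacian {W : Type*} [NormedAddCommGroup W] [NormedSpace ℝ W]
    {f : EuclideanSpace ℝ (Fin m) → W} {G : EuclideanSpace ℝ (Fin m) → Matrix (Fin m) (Fin m) ℝ}
    (hG : ∀ i j, ContDiffAt ℝ ∞ (fun v => G v i j) u) (hu : IsUnit (G u).det)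
    (hf : ContDiffAt ℝ ∞ f u) : ContDiffAt ℝ ∞ (laplacian G f) u :=
  ContDiffAt.sum fun i _ => ContDiffAt.sum fun j _ => (contDiffAt_matrix_inv hG hu i j).smul
    ((contDiffAt_pd (contDiffAt_pd hf j) i).sub (ContDiffAt.sum fun k _ =>
      (contDiffAt_christoffel hG hu k i j).smul (contDiffAt_pd hf k)))

theorem contDiffAt_coordFactor (hF : ContDiffAt ℝ ∞ F u)
    (hu : IsUnit (inducedMatrix n p F u).det) : ContDiffAt ℝ ∞ (coordFactor n p F) u := by
  have hG := contDiffAt_inducedMatrix (p := p) hF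
  have hL := contDiffAt_laplacian hG hu hF
  exact (((lor n p).contDiff.contDiffAt.comp u hL).clm_apply hL).sub
    (contDiffAt_const.mul (contDiffAt_normScalarCurvature hG hu))

variable {M : Type*} [TopologicalSpace M] [ChartedSpace (EuclideanSpace ℝ (Fin m)) M]
  {x : M → ConformalSpace n p} {U : Set M} {y : M → Amb n}
  {φ : OpenPartialHomeomorph M (EuclideanSpace ℝ (Fin m))} {q : M}

theorem contMDiffAt_conformalFactor (h : IsLocalLift m x U y)
    (hφ : φ ∈ IsManifold.maximalAtlas (𝓡 m) ∞ M) (hq : q ∈ U ∩ φ.source)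
    (hy : NondegenerateAt m (inducedForm m p y q)) :
    ContMDiffAt (𝓡 m) 𝓘(ℝ, ℝ) ∞ (conformalFactor m p φ y) q :=
  ContMDiffAt.comp (I' := 𝓡 m) q (contDiffAt_coordFactor
    (h.eventually_contDiffAt hφ hq).self_of_nhds
    (isUnit_det_inducedMatrix hφ hq.2 (h.contMDiffAt hq.1) hy)).contMDiffAt
    (contMDiffAt_of_mem_maximalAtlas hφ hq.2)

variable [IsManifold (𝓡 m) ∞ M]

theorem contMDiffAt_conformalForm (ε : ℝ) (h : IsLocalLift m x U y)
    (hφ : φ ∈ IsManifold.maximalAtlas (𝓡 m) ∞ M) (hq : q ∈ U ∩ φ.source)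
    (hy : NondegenerateAt m (inducedForm m p y q)) :
    ContMDiffAt (𝓡 m)
      ((𝓡 m).prod 𝓘(ℝ, EuclideanSpace ℝ (Fin m) →L[ℝ] EuclideanSpace ℝ (Fin m) →L[ℝ] ℝ)) ∞
      (fun r => Bundle.TotalSpace.mk'
        (EuclideanSpace ℝ (Fin m) →L[ℝ] EuclideanSpace ℝ (Fin m) →L[ℝ] ℝ) r
        (conformalForm m p ε φ y r)) q := by
  have hD := ContMDiffAt.mfderiv_const (m := ∞) (h.contMDiffAt hq.1) (by simp)
  have hc := contMDiffAt_conformalFactor h hφ hq hy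
  rw [contMDiffAt_hom_bundle]
  refine ⟨contMDiffAt_id, ?_⟩
  set D := inTangentCoordinates (𝓡 m) 𝓘(ℝ, Amb n) id y (mfderiv (𝓡 m) 𝓘(ℝ, Amb n) y) q with hDdef
  have hB : ContMDiffAt (𝓡 m)
      𝓘(ℝ, EuclideanSpace ℝ (Fin m) →L[ℝ] EuclideanSpace ℝ (Fin m) →L[ℝ] ℝ) ∞
      (fun r => (ε * conformalFactor m p φ y r) • (lor n p).bilinearComp (D r) (D r)) q := by
    exact (contMDiffAt_const.mul hc).smul
      ((contDiff_bilinearComp_self (lor n p)).contMDiff.contMDiffAt.comp q hD)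
  refine hB.congr_of_eventuallyEq ?_
  filter_upwards [(chartAt (EuclideanSpace ℝ (Fin m)) q).open_source.mem_nhds
    (mem_chart_source _ q)] with r hr
  have hr' : r ∈ (trivializationAt (EuclideanSpace ℝ (Fin m)) (TangentSpace (𝓡 m)) q).baseSet := hr
  have hDr : ∀ v, D r v = mfderiv (𝓡 m) 𝓘(ℝ, Amb n) y r
      ((trivializationAt (EuclideanSpace ℝ (Fin m)) (TangentSpace (𝓡 m)) q).symm r v) := by
    intro v
    simp only [hDdef, inTangentCoordinates, ContinuousLinearMap.inCoordinates]
    rw [TangentBundle.continuousLinearMapAt_model_space]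
    change mfderiv (𝓡 m) 𝓘(ℝ, Amb n) y r (Bundle.Trivialization.symmL ℝ (trivializationAt
      (EuclideanSpace ℝ (Fin m)) (TangentSpace (𝓡 m)) q) r v) = _
    rw [Bundle.Trivialization.symmL_apply _ hr']
  ext v w
  refine (inCoordinates_apply_eq₂ (F₃ := ℝ) (E₃ := Bundle.Trivial M ℝ) hr' hr' (by simp)).trans ?_
  simp only [Bundle.Trivial.fiberBundle_trivializationAt',
    Bundle.Trivial.linearMapAt_trivialization]
  change (ε * conformalFactor m p φ y r) * _ =
    (ε * conformalFactor m p φ y r) * lor n p (D r v) (D r w)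
  rw [hDr, hDr]
  rfl

end Smooth

/-! ### Lorentzian transformations -/

section Lorentz
open Filter Topology
variable {m n p : ℕ}

/-- The linear automorphism `X ↦ X T` of `ℝ^(n+2)`. -/
def lorentzEquiv (T : lorentzGroup n p) : Amb n ≃L[ℝ] Amb n :=
  LinearEquiv.toContinuousLinearEquiv
    { Matrix.vecMulLinear ((T : GL (Fin (n + 2)) ℝ) : Matrix (Fin (n + 2)) (Fin (n + 2)) ℝ) with
      invFun := fun X => X ᵥ* ((T⁻¹ : GL (Fin (n + 2)) ℝ) : Matrix (Fin (n + 2)) (Fin (n + 2)) ℝ)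
      left_inv := fun X => by
        simp [Matrix.vecMul_vecMul, ← Units.val_mul, -Matrix.coe_units_inv]
      right_inv := fun X => by
        simp [Matrix.vecMul_vecMul, ← Units.val_mul, -Matrix.coe_units_inv] }

theorem lor_lorentzEquiv (T : lorentzGroup n p) (X Y : Amb n) :
    lor n p (lorentzEquiv T X) (lorentzEquiv T Y) = lor n p X Y := T.2 X Y

theorem lorentzMap_lorentzMap_inv (T : lorentzGroup n p) (P : ConformalSpace n p) :
    lorentzMap T⁻¹ (lorentzMap T P) = P := by
  obtain ⟨_, X, hX, rfl⟩ := P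
  have h : (X ᵥ* ((T : GL (Fin (n + 2)) ℝ) : Matrix (Fin (n + 2)) (Fin (n + 2)) ℝ)) ᵥ*
      (((T⁻¹ : lorentzGroup n p) : GL (Fin (n + 2)) ℝ) : Matrix (Fin (n + 2)) (Fin (n + 2)) ℝ)
      = X := by
    rw [Matrix.vecMul_vecMul, ← Units.val_mul, ← Subgroup.coe_mul, mul_inv_cancel,
      Subgroup.coe_one, Units.val_one, Matrix.vecMul_one]
  refine (lorentzMap_mk T⁻¹ _
    ⟨(T.2 X X).trans hX.1, vecMul_ne_zero (T : GL (Fin (n + 2)) ℝ) hX.2⟩).trans ?_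
  simp only [h]
  rfl

section Coordinates

variable {L : Amb n ≃L[ℝ] Amb n} {F : EuclideanSpace ℝ (Fin m) → Amb n}

theorem pd_comp_equiv (L : Amb n ≃L[ℝ] Amb n) (F : EuclideanSpace ℝ (Fin m) → Amb n) (i : Fin m) :
    pd i (L ∘ F) = L ∘ pd i F := by
  ext1 u
  simp [pd, L.comp_fderiv]

theorem inducedMatrix_comp_equiv (hL : ∀ X Y, lor n p (L X) (L Y) = lor n p X Y) :
    inducedMatrix n p (L ∘ F) = inducedMatrix n p F := by
  ext u i j
  simp only [inducedMatrix, Matrix.of_apply, pd_comp_equiv, Function.comp_apply, hL]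

theorem laplacian_comp_equiv (G : EuclideanSpace ℝ (Fin m) → Matrix (Fin m) (Fin m) ℝ)
    (L : Amb n ≃L[ℝ] Amb n) (F : EuclideanSpace ℝ (Fin m) → Amb n)
    (u : EuclideanSpace ℝ (Fin m)) : laplacian G (L ∘ F) u = L (laplacian G F u) := by
  simp only [laplacian, pd_comp_equiv, Function.comp_apply, map_sum, map_smul, map_sub]

theorem coordFactor_comp_equiv (hL : ∀ X Y, lor n p (L X) (L Y) = lor n p X Y)
    (u : EuclideanSpace ℝ (Fin m)) : coordFactor n p (L ∘ F) u = coordFactor n p F u := by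
  simp only [coordFactor, inducedMatrix_comp_equiv hL, laplacian_comp_equiv, hL]

end Coordinates

variable {M : Type*} [TopologicalSpace M] [ChartedSpace (EuclideanSpace ℝ (Fin m)) M]
  {x : M → ConformalSpace n p} {U : Set M} {y : M → Amb n}
  {φ : OpenPartialHomeomorph M (EuclideanSpace ℝ (Fin m))} {q : M}

theorem IsLocalLift.lorentzEquiv_comp (h : IsLocalLift m x U y) (T : lorentzGroup n p) :
    IsLocalLift m (lorentzMap T ∘ x) U (lorentzEquiv T ∘ y) := by
  refine ⟨h.1, (lorentzEquiv T).contDiff.contMDiff.comp_contMDiffOn h.2.1, fun q hq => ?_⟩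
  obtain ⟨h1, h2⟩ := h.2.2 q hq
  exact ⟨⟨(T.2 _ _).trans h1.1, vecMul_ne_zero _ h1.2⟩, congrArg (lorentzMap T) h2⟩

theorem inducedForm_lorentzEquiv_comp (hy : MDifferentiableAt (𝓡 m) 𝓘(ℝ, Amb n) y q)
    (T : lorentzGroup n p) : inducedForm m p (lorentzEquiv T ∘ y) q = inducedForm m p y q := by
  have h1 := ((lorentzEquiv T).toContinuousLinearMap.hasMFDerivAt.comp q hy.hasMFDerivAt).mfderiv
  ext v w
  simp only [inducedForm]
  erw [h1]
  exact lor_lorentzEquiv T _ _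

theorem conformalForm_lorentzEquiv_comp (ε : ℝ)
    (hy : MDifferentiableAt (𝓡 m) 𝓘(ℝ, Amb n) y q) (T : lorentzGroup n p) :
    conformalForm m p ε φ (lorentzEquiv T ∘ y) q = conformalForm m p ε φ y q := by
  have h : conformalFactor m p φ (lorentzEquiv T ∘ y) q = conformalFactor m p φ y q :=
    coordFactor_comp_equiv (L := lorentzEquiv T) (F := y ∘ φ.symm) (lor_lorentzEquiv T) (φ q)
  rw [conformalForm, conformalForm, inducedForm_lorentzEquiv_comp hy, h]

/-- The part of the square of the Euclidean norm coming from the positive coordinates. -/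
def posPart (n p : ℕ) (X : Amb n) : ℝ :=
  ∑ i ∈ Finset.univ.filter (fun i : Fin (n + 2) => (i : ℕ) + p < n + 1), X i ^ 2

theorem lor_self_eq (X : Amb n) : lor n p X X = posPart n p X -
    ∑ i ∈ Finset.univ.filter (fun i : Fin (n + 2) => ¬ (i : ℕ) + p < n + 1), X i ^ 2 := by
  rw [lor_apply, ← Finset.sum_filter_add_sum_filter_not _
    (fun i : Fin (n + 2) => (i : ℕ) + p < n + 1), sub_eq_add_neg, ← Finset.sum_neg_distrib]
  refine congrArg₂ _ (Finset.sum_congr rfl fun i hi => ?_) (Finset.sum_congr rfl fun i hi => ?_)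
  · rw [sgn, if_pos (Finset.mem_filter.1 hi).2]; ring
  · rw [sgn, if_neg (Finset.mem_filter.1 hi).2]; ring

theorem posPart_pos {X : Amb n} (hX : X ∈ nullCone n p) : 0 < posPart n p X := by
  have h1 := lor_self_eq (p := p) X
  rw [hX.1] at h1
  obtain ⟨i, hi⟩ := Function.ne_iff.1 hX.2
  have hpos : 0 < X i ^ 2 := by have : X i ≠ 0 := hi; positivity
  by_cases hip : (i : ℕ) + p < n + 1
  · exact hpos.trans_le (Finset.single_le_sum (f := fun i => X i ^ 2) (fun j _ => sq_nonneg (X j))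
      (Finset.mem_filter.2 ⟨Finset.mem_univ i, hip⟩))
  · have := hpos.trans_le (Finset.single_le_sum (f := fun i => X i ^ 2)
      (s := Finset.univ.filter fun i : Fin (n + 2) => ¬ (i : ℕ) + p < n + 1)
      (fun j _ => sq_nonneg (X j)) (Finset.mem_filter.2 ⟨Finset.mem_univ i, hip⟩))
    linarith

theorem inv_sqrt_posPart_smul_mem {X : Amb n} (hX : X ∈ nullCone n p) :
    (√(posPart n p X))⁻¹ • X ∈ sphereProduct n p := by
  have h0 := posPart_pos hX
  have h1 := lor_self_eq (p := p) X
  rw [hX.1] at h1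
  have h2 : ((√(posPart n p X))⁻¹) ^ 2 * posPart n p X = 1 := by
    rw [inv_pow, Real.sq_sqrt h0.le, inv_mul_cancel₀ h0.ne']
  constructor
  · simp only [Pi.smul_apply, smul_eq_mul, mul_pow, ← Finset.mul_sum]
    exact h2
  · simp only [Pi.smul_apply, smul_eq_mul, mul_pow, ← Finset.mul_sum]
    rw [← sub_eq_zero.1 h1.symm, h2]

/-- Rescaling a local lift to take values in the product of the two spheres gives a local lift. -/
theorem IsLocalLift.normalize (h : IsLocalLift m x U y) :
    IsLocalLift m x U fun r => (√(posPart n p (y r)))⁻¹ • y r := by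
  refine ⟨h.1, ?_, fun q hq => ?_⟩
  · have hP : ContDiff ℝ ∞ (posPart n p) := by
      unfold posPart
      fun_prop
    have h1 : ContMDiffOn (𝓡 m) 𝓘(ℝ, ℝ) ∞ (fun r => posPart n p (y r)) U :=
      hP.contMDiff.comp_contMDiffOn h.2.1
    intro r hr
    have h2 := posPart_pos (h.2.2 r hr).1
    have h3 : ContDiffAt ℝ ∞ (fun t : ℝ => (√t)⁻¹) (posPart n p (y r)) :=
      (Real.contDiffAt_sqrt h2.ne').inv (Real.sqrt_pos.2 h2).ne'
    exact (h3.contMDiffAt.comp_contMDiffWithinAt r (h1 r hr)).smul (h.2.1 r hr)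
  · obtain ⟨h1, h2⟩ := h.2.2 q hq
    have h3 : (√(posPart n p (y q)))⁻¹ ≠ 0 := inv_ne_zero (Real.sqrt_pos.2 (posPart_pos h1)).ne'
    refine ⟨⟨by simp [h1.1], smul_ne_zero h3 h1.2⟩, ?_⟩
    rw [← h2]
    exact Subtype.ext ((Projectivization.mk_eq_mk_iff' ℝ _ _ _ _).2 ⟨_, rfl⟩)

variable [IsManifold (𝓡 m) ∞ M]

theorem IsPseudoRiemannianSubmanifold.nondegenerateAt (hx : IsPseudoRiemannianSubmanifold m x)
    (h : IsLocalLift m x U y) (hq : q ∈ U) : NondegenerateAt m (inducedForm m p y q) := by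
  obtain ⟨V, z, hqV, hz, -, hn⟩ := hx q
  exact hz.nondegenerateAt h hqV hq hn

theorem IsPseudoRiemannianSubmanifold.lorentzMap_comp (hx : IsPseudoRiemannianSubmanifold m x)
    (T : lorentzGroup n p) : IsPseudoRiemannianSubmanifold m (lorentzMap T ∘ x) := by
  intro q
  obtain ⟨U, y, hq, h, -, hn⟩ := hx q
  have h1 := h.lorentzEquiv_comp T
  refine ⟨U, _, hq, h1.normalize, fun r hr => inv_sqrt_posPart_smul_mem (h1.2.2 r hr).1,
    h1.nondegenerateAt h1.normalize hq hq ?_⟩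
  rwa [inducedForm_lorentzEquiv_comp ((h.contMDiffAt hq).mdifferentiableAt (by simp))]

theorem IsConformalTwoForm.of_lorentzMap_comp {ε : ℝ} {T : lorentzGroup n p}
    {g : ∀ q : M, TangentSpace (𝓡 m) q →L[ℝ] TangentSpace (𝓡 m) q →L[ℝ] ℝ}
    (hg : IsConformalTwoForm m (lorentzMap T ∘ x) ε g) : IsConformalTwoForm m x ε g := by
  refine ⟨hg.1, fun U y h φ hφ q hq => ?_⟩
  rw [hg.2 U _ (h.lorentzEquiv_comp T) φ hφ q hq]
  exact conformalForm_lorentzEquiv_comp ε ((h.contMDiffAt hq.1).mdifferentiableAt (by simp)) T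

theorem isConformalTwoForm_lorentzMap_comp_iff {ε : ℝ} (T : lorentzGroup n p)
    (g : ∀ q : M, TangentSpace (𝓡 m) q →L[ℝ] TangentSpace (𝓡 m) q →L[ℝ] ℝ) :
    IsConformalTwoForm m x ε g ↔ IsConformalTwoForm m (lorentzMap T ∘ x) ε g := by
  refine ⟨fun hg => IsConformalTwoForm.of_lorentzMap_comp (T := T⁻¹) ?_,
    fun hg => hg.of_lorentzMap_comp⟩
  have h : lorentzMap T⁻¹ ∘ lorentzMap T ∘ x = x :=
    funext fun q => lorentzMap_lorentzMap_inv T (x q)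
  rwa [h]

theorem existsUnique_isConformalTwoForm (hm : 2 ≤ m) (hx : IsPseudoRiemannianSubmanifold m x)
    (ε : ℝ) : ∃! g : ∀ q : M, TangentSpace (𝓡 m) q →L[ℝ] TangentSpace (𝓡 m) q →L[ℝ] ℝ,
      IsConformalTwoForm m x ε g := by
  have hn := fun (U : Set M) (y : M → Amb n) (h : IsLocalLift m x U y) (q : M) (hq : q ∈ U) =>
    hx.nondegenerateAt h hq
  choose V z hqV hz _ _ using hx
  have hatlas : ∀ q : M, chartAt (EuclideanSpace ℝ (Fin m)) q ∈
      IsManifold.maximalAtlas (𝓡 m) ∞ M := fun q => IsManifold.chart_mem_maximalAtlas q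
  have hmem : ∀ q : M, q ∈ V q ∩ (chartAt (EuclideanSpace ℝ (Fin m)) q).source := fun q =>
    ⟨hqV q, mem_chart_source _ q⟩
  have key : ∀ (U : Set M) (y : M → Amb n), IsLocalLift m x U y →
      ∀ φ ∈ IsManifold.maximalAtlas (𝓡 m) ∞ M, ∀ q ∈ U ∩ φ.source,
        conformalForm m p ε (chartAt (EuclideanSpace ℝ (Fin m)) q) (z q) q =
          conformalForm m p ε φ y q := fun U y h φ hφ q hq =>
    conformalForm_eq hm ε (hz q) h (hatlas q) hφ (hmem q) hq
      (hn _ _ (hz q) q (hqV q))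
  refine ⟨fun q => conformalForm m p ε (chartAt _ q) (z q) q, ⟨fun q => ?_, key⟩, fun g hg => ?_⟩
  · refine (contMDiffAt_conformalForm ε (hz q) (hatlas q) (hmem q)
      (hn _ _ (hz q) q (hqV q))).congr_of_eventuallyEq ?_
    filter_upwards [(hz q).1.mem_nhds (hqV q),
      (chartAt (EuclideanSpace ℝ (Fin m)) q).open_source.mem_nhds
      (mem_chart_source _ q)] with r h1 h2
    rw [key (V q) (z q) (hz q) _ (hatlas q) r ⟨h1, h2⟩]
  · funext q
    exact hg.2 (V q) (z q) (hz q) _ (hatlas q) q (hmem q)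

end Lorentz

end ConformalGeometry

end

open ConformalGeometry in
theorem theorem3p1 {m n p : ℕ} (hm : 2 ≤ m) (hp : p ≤ n)
    {M : Type*} [TopologicalSpace M] [ChartedSpace (EuclideanSpace ℝ (Fin m)) M]
    [IsManifold (𝓡 m) ∞ M]
    (x : M → ConformalSpace n p) (hx : IsPseudoRiemannianSubmanifold m x)
    (ε : ℝ) (hε : ε = 1 ∨ ε = -1) :
    -- the metric of every local lift is nondegenerate
    (∀ (U : Set M) (y : M → Amb n), IsLocalLift m x U y →
      ∀ q ∈ U, NondegenerateAt m (inducedForm m p y q)) ∧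
    -- the form does not depend on the lift (nor on the coordinates used to compute it)
    (∀ (U U' : Set M) (y y' : M → Amb n), IsLocalLift m x U y → IsLocalLift m x U' y' →
      ∀ φ ∈ IsManifold.maximalAtlas (𝓡 m) ∞ M, ∀ φ' ∈ IsManifold.maximalAtlas (𝓡 m) ∞ M,
      ∀ q ∈ (U ∩ φ.source) ∩ (U' ∩ φ'.source),
        conformalForm m p ε φ y q = conformalForm m p ε φ' y' q) ∧
    -- it is a globally defined smooth field of bilinear forms
    (∃! g : ∀ q : M, TangentSpace (𝓡 m) q →L[ℝ] TangentSpace (𝓡 m) q →L[ℝ] ℝ,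
      IsConformalTwoForm m x ε g) ∧
    -- it is the same for the image of the submanifold under a Lorentzian transformation
    (∀ T : lorentzGroup n p,
      IsPseudoRiemannianSubmanifold m (lorentzMap T ∘ x) ∧
      ∀ g : ∀ q : M, TangentSpace (𝓡 m) q →L[ℝ] TangentSpace (𝓡 m) q →L[ℝ] ℝ,
        IsConformalTwoForm m x ε g ↔ IsConformalTwoForm m (lorentzMap T ∘ x) ε g) := by
  exact ⟨fun U y h q hq => hx.nondegenerateAt h hq,
    fun U U' y y' h h' φ hφ φ' hφ' q hq =>
      conformalForm_eq hm ε h h' hφ hφ' hq.1 hq.2 (hx.nondegenerateAt h hq.1.1),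
    existsUnique_isConformalTwoForm hm hx ε,
    fun T => ⟨hx.lorentzMap_comp T, isConformalTwoForm_lorentzMap_comp_iff T⟩⟩
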